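/- Conventions. For a finite simplicial complex $X$ with vertex set $V$, realize each simplex as the corresponding face of the standard simplex in $\mathbb R^V$, with the Euclidean metric (the standard simplexwise metric). A simplexwise smooth $k$-form on $X$ is a family of $k$-forms, one on each closed simplex of $X$ and smooth up to its boundary, such that the form on each face is the pullback of the form on every simplex containing it; $\Omega^k(X)$ is the space of these, and the exterior derivative $d$ is taken simplex by simplex. For a subcomplex $A\subset X$, $\Omega^k(X,A)\subset\Omega^k(X)$ is the subspace of forms whose restriction to every simplex of $A$ is zero. $\|\omega\|_\infty$ is the supremum, over all points of all simplices, of the pointwise comass norm of $\omega$. $\Delta^n$ is the standard $n$-simplex, and $\partial\Delta^n$ is its boundary complex. (1) (First quantitative Poincaré lemma.) For all integers $0<k\le n$ there is a constant $C_{n,k}$ such that the following holds. Let $\omega\in\Omega^k(\Delta^n,\partial\Delta^n)$ be closed and, if $k=n$, suppose in addition that $\int_{\Delta^n}\omega=0$. Then there is $\alpha\in\Omega^{k-1}(\Delta^n,\partial\Delta^n)$ with $d\alpha=\omega$ and $\|\alpha\|_\infty\le C_{n,k}\|\omega\|_\infty$. (2) (Second quantitative Poincaré lemma.) For all integers $0<k\le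 n$ there is a constant $C'_{n,k}$ such that the following holds. Let $\omega\in\Omega^k(\Delta^n)$ be closed and let $\alpha_\partial\in\Omega^{k-1}(\partial\Delta^n)$ satisfy $d\alpha_\partial=\omega|_{\partial\Delta^n}$; if $k=n$, suppose in addition that $\int_{\Delta^n}\omega=\int_{\partial\Delta^n}\alpha_\partial$, where $\partial\Delta^n$ has the boundary orientation. Then there is $\alpha\in\Omega^{k-1}(\Delta^n)$ with $\alpha|_{\partial\Delta^n}=\alpha_\partial$, $d\alpha=\omega$ and $\|\alpha\|_\infty\le C'_{n,k}(\|\omega\|_\infty+\|\alpha_\partial\|_\infty)$. (3) Let $A\subset X$ be a finite simplicial pair. For every $k\ge1$ there is a constant $C(k,X,A)$ such that for every $\omega\in d\,\Omega^{k-1}(X,A)$ there is $\alpha\in\Omega^{k-1}(X,A)$ with $d\alpha=\omega$ and $\|\alpha\|_\infty\le C(k,X,A)\|\omega\|_\infty$. -/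

import Mathlib

open scoped ENNReal NNReal

noncomputable section

namespace SimplicialForms

variable {V : Type*} [Fintype V]

/-- The closed simplex spanned by the vertices `s`: the points of `ℝ^V` with nonnegative
coordinates of sum `1` that are supported in `s`.  The standard simplexwise metric is the
one induced from the Euclidean metric of `ℝ^V`; every simplex is a regular simplex. -/
def closedSimplex (s : Finset V) : Set (EuclideanSpace ℝ V) :=
  {x | (∀ i, 0 ≤ x i) ∧ (∀ i, i ∉ s → x i = 0) ∧ ∑ i, x i = 1}

/-- The tangent space of the simplex spanned by `s`, with the norm induced from the Euclidean
norm of `ℝ^V`. -/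
def simplexDir (s : Finset V) : Submodule ℝ (EuclideanSpace ℝ V) where
  carrier := {v | (∀ i, i ∉ s → v i = 0) ∧ ∑ i, v i = 0}
  add_mem' := by
    rintro a b ⟨ha, ha'⟩ ⟨hb, hb'⟩
    refine ⟨fun i hi => by simp [ha i hi, hb i hi], ?_⟩
    simp [Finset.sum_add_distrib, ha', hb']
  zero_mem' := by simp
  smul_mem' := by
    rintro c a ⟨ha, ha'⟩
    refine ⟨fun i hi => by simp [ha i hi], ?_⟩
    simp [← Finset.mul_sum, ha']

theorem simplexDir_mono {s t : Finset V} (h : s ⊆ t) : simplexDir s ≤ simplexDir t :=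
  fun _ hv => ⟨fun i hi => hv.1 i fun his => hi (h his), hv.2⟩

variable [DecidableEq V]

/-- The vector from the vertex `i` to the vertex `j`, as a tangent vector of a simplex that
contains both. -/
def edgeVec (s : Finset V) (i j : V) (hi : i ∈ s) (hj : j ∈ s) : simplexDir s :=
  ⟨EuclideanSpace.single j 1 - EuclideanSpace.single i 1, by
    refine ⟨fun l hl => ?_, by simp [Finset.sum_sub_distrib]⟩
    have h1 : l ≠ j := fun h => hl (h ▸ hj)
    have h2 : l ≠ i := fun h => hl (h ▸ hi)
    simp [h1, h2]⟩

/-- The barycentre of the simplex spanned by `s`. -/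
def barycenter (s : Finset V) : EuclideanSpace ℝ V :=
  (s.card : ℝ)⁻¹ • ∑ i ∈ s, EuclideanSpace.single i (1 : ℝ)

/-- The isometric parametrization of the affine span of the simplex spanned by `s` by its
tangent space, with the barycentre as origin. -/
def chart (s : Finset V) (v : simplexDir s) : EuclideanSpace ℝ V :=
  barycenter s + (v : EuclideanSpace ℝ V)

/-- The closed simplex read in its chart. -/
def chartDomain (s : Finset V) : Set (simplexDir s) :=
  {v | chart s v ∈ closedSimplex s}

/-- A simplexwise smooth `k`-form on the simplicial complex `K`: a form on every closed
simplex, smooth up to the boundary, such that the form on a face is the pullback (restriction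
to tangent vectors of the face) of the form on the simplex.  Only the values `toFun s x` with
`s` a simplex of `K` and `x` a point of that simplex are meaningful. -/
structure SimplexwiseForm (K : PreAbstractSimplicialComplex V) (k : ℕ) where
  toFun : (s : Finset V) → EuclideanSpace ℝ V → simplexDir s [⋀^Fin k]→L[ℝ] ℝ
  smooth : ∀ s ∈ K.faces, ContDiffOn ℝ ((⊤ : ℕ∞) : WithTop ℕ∞)
    (fun v => toFun s (chart s v)) (chartDomain s)
  compatible : ∀ s ∈ K.faces, ∀ t ∈ K.faces, ∀ h : s ⊆ t, ∀ x ∈ closedSimplex s,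
    ∀ w : Fin k → simplexDir s,
      toFun t x (fun j => Submodule.inclusion (simplexDir_mono h) (w j)) = toFun s x w

namespace SimplexwiseForm

variable {K A : PreAbstractSimplicialComplex V} {k : ℕ}

/-- The exterior derivative of the form on the simplex `s`, at the point `chart s v`. -/
def dAt (ω : SimplexwiseForm K k) (s : Finset V) (v : simplexDir s) :
    simplexDir s [⋀^Fin (k + 1)]→L[ℝ] ℝ :=
  extDerivWithin (fun v => ω.toFun s (chart s v)) (chartDomain s) v

/-- `dα = ω`. -/
def IsPrimitiveOf (α : SimplexwiseForm K k) (ω : SimplexwiseForm K (k + 1)) : Prop :=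
  ∀ s ∈ K.faces, ∀ v ∈ chartDomain s, α.dAt s v = ω.toFun s (chart s v)

/-- `dω = 0`. -/
def IsClosedForm (ω : SimplexwiseForm K k) : Prop :=
  ∀ s ∈ K.faces, ∀ v ∈ chartDomain s, ω.dAt s v = 0

/-- The restriction of a form to a subcomplex. -/
def restrict (ω : SimplexwiseForm K k) (h : A ≤ K) : SimplexwiseForm A k where
  toFun := ω.toFun
  smooth s hs := ω.smooth s (h hs)
  compatible s hs t ht := ω.compatible s (h hs) t (h ht)

/-- Equality of two forms: they agree at all points of all simplices of the complex. -/
def Agrees (ω η : SimplexwiseForm K k) : Prop :=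
  ∀ s ∈ K.faces, ∀ x ∈ closedSimplex s, ω.toFun s x = η.toFun s x

/-- The form is zero at all points of all simplices of the complex. -/
def IsZero (ω : SimplexwiseForm K k) : Prop :=
  ∀ s ∈ K.faces, ∀ x ∈ closedSimplex s, ω.toFun s x = 0

/-- The `L^∞` norm: the supremum, over the points of all simplices, of the comass
`sup |ω_x(v₁, …, v_k)|` over tangent vectors of Euclidean length at most `1`. -/
def supNorm (ω : SimplexwiseForm K k) : ℝ≥0∞ :=
  ⨆ s ∈ K.faces, ⨆ x ∈ closedSimplex s, ‖ω.toFun s x‖ₑ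

/-- The integral of a `k`-form over the `k`-simplex spanned by `s`, oriented by the order
`p 0 < ⋯ < p k` of its vertices: the integral, over the points `y` of `ℝ^k` with `0 ≤ y j` and
`∑ y j ≤ 1`, of the pullback under `y ↦ p 0 + ∑ j, y j (p (j + 1) - p 0)`. -/
def integral [LinearOrder V] (ω : SimplexwiseForm K k) (s : Finset V) (hs : s.card = k + 1) : ℝ :=
  let u : Fin k → simplexDir s := fun j =>
    edgeVec s (s.orderEmbOfFin hs 0) (s.orderEmbOfFin hs j.succ)
      (s.orderEmbOfFin_mem hs 0) (s.orderEmbOfFin_mem hs j.succ)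
  ∫ y in {y : Fin k → ℝ | (∀ j, 0 ≤ y j) ∧ ∑ j, y j ≤ 1},
    ω.toFun s (EuclideanSpace.single (s.orderEmbOfFin hs 0) 1 + ∑ j, y j • (u j).val) u

end SimplexwiseForm

/-- The standard `n`-simplex as a simplicial complex: all nonempty sets of its `n + 1`
vertices. -/
def stdComplex (n : ℕ) : PreAbstractSimplicialComplex (Fin (n + 1)) := ⊤

/-- The boundary of the standard `n`-simplex: all proper faces. -/
def bdryComplex (n : ℕ) : PreAbstractSimplicialComplex (Fin (n + 1)) where
  faces := {s | s.Nonempty ∧ s ≠ Finset.univ}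
  isRelLowerSet_faces := by
    rintro s ⟨hs, hs'⟩
    refine ⟨hs, fun t hts ht => ⟨ht, fun h => hs' ?_⟩⟩
    exact Finset.univ_subset_iff.1 (h ▸ hts)

theorem bdryComplex_le (n : ℕ) : bdryComplex n ≤ stdComplex n := fun _ hs => hs.1

/-- The integral over the standard `n`-simplex of an `n`-form. -/
def stdIntegral {n k : ℕ} (ω : SimplexwiseForm (stdComplex n) k) (h : k = n) : ℝ :=
  ω.integral Finset.univ (by simp [h])

/-- The integral over the boundary of the standard `n`-simplex of an `(n - 1)`-form, with the
boundary orientation. -/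
def bdryIntegral {n k : ℕ} (α : SimplexwiseForm (bdryComplex n) k) (h : k + 1 = n) : ℝ :=
  ∑ i : Fin (n + 1), (-1 : ℝ) ^ (i : ℕ) * α.integral (Finset.univ.erase i) (by simp [h])

end SimplicialForms

end

open SimplicialForms

/-! On one simplex, integrate a closed form `ω` that vanishes on the boundary over the cones with
a fixed vertex `q` as apex. The resulting primitive vanishes on the faces through `q`. On the face
opposite to `q` it need not, but its restriction there is closed and vanishes on the boundary of
that face, so by induction on the dimension this restriction has a primitive. Pulled back along
the collapses of `q` to the other vertices, with the barycentric coordinates as weights, that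
primitive extends to a form on the simplex that vanishes on the faces through `q`, and the
derivative of the extension is the required correction. In top degree the induction meets the
hypothesis on the integral, because the integral over the face of the cone primitive of `ω` is up
to sign the integral of `ω`. The supremum norm of a form does not control that of its derivative;
the bounds hold because only forms whose derivatives are known are extended.

To prescribe the values on the boundary, extend them face by face to the simplex and subtract the
derivative of the extension; Stokes' theorem turns the hypothesis on the integrals into the one of
the first lemma.

On a complex, extend a primitive from skeleton to skeleton. The only obstruction is that on every
`(k + 1)`-simplex the integral of `ω` must equal the boundary integral of the primitive. The
integrals of `ω = dβ` lie in the image of a linear map of `β` to a finite-dimensional space, which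
has a linear generalized inverse, bounded on that space; subtracting the derivative of its value
reduces to forms whose integrals all vanish, for which the primitive can be taken to be zero on
the `k`-simplices. -/

noncomputable section

namespace SimplicialForms

open scoped ContDiff Topology
open Set

/-! ### Averages over the segments issuing from a point -/

section ConeAverage

variable {E G : Type*} [NormedAddCommGroup E] [NormedSpace ℝ E] [NormedAddCommGroup G]
  [NormedSpace ℝ G] {D : Set E} {p x : E} {f : E → G}

/-- The weighted average `∫₀¹ tᵐ f(p + t (x - p)) dt` of `f` over the segment from `p` to `x`;
the cone operator on forms of degree `m + 1` contracts it with `x - p`. -/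
def coneAverage (m : ℕ) (p : E) (f : E → G) (x : E) : G :=
  ∫ t in (0 : ℝ)..1, t ^ m • f (AffineMap.lineMap p x t)

theorem lineMap_sub_lineMap_left (p x y : E) (t : ℝ) :
    AffineMap.lineMap p y t - AffineMap.lineMap p x t = t • (y - x) := by
  simp only [AffineMap.lineMap_apply_module', add_sub_add_right_eq_sub, ← smul_sub,
    sub_sub_sub_cancel_right]

theorem continuousOn_comp_lineMap {Y : Type*} [TopologicalSpace Y] {f : E → Y}
    (hD : Convex ℝ D) (hp : p ∈ D) (hx : x ∈ D) (hf : ContinuousOn f D) :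
    ContinuousOn (fun t : ℝ => f (AffineMap.lineMap p x t)) (Icc 0 1) :=
  hf.comp AffineMap.lineMap_continuous.continuousOn fun _ ht => hD.lineMap_mem hp hx ht

theorem continuousOn_coneAverage_integrand (hD : Convex ℝ D) (hp : p ∈ D) (hx : x ∈ D)
    (hf : ContinuousOn f D) (m : ℕ) :
    ContinuousOn (fun t : ℝ => t ^ m • f (AffineMap.lineMap p x t)) (Icc 0 1) :=
  (continuous_pow m).continuousOn.smul (continuousOn_comp_lineMap hD hp hx hf)

theorem intervalIntegrable_coneAverage_integrand (hD : Convex ℝ D) (hp : p ∈ D) (hx : x ∈ D)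
    (hf : ContinuousOn f D) (m : ℕ) :
    IntervalIntegrable (fun t : ℝ => t ^ m • f (AffineMap.lineMap p x t))
      MeasureTheory.volume 0 1 :=
  (continuousOn_coneAverage_integrand hD hp hx hf m).intervalIntegrable_of_Icc zero_le_one

theorem coneAverage_congr (hD : Convex ℝ D) (hp : p ∈ D) (hx : x ∈ D) {g : E → G}
    (h : EqOn f g D) (m : ℕ) : coneAverage m p f x = coneAverage m p g x := by
  refine intervalIntegral.integral_congr fun t ht => ?_
  rw [uIcc_of_le zero_le_one] at ht
  simp only [h (hD.lineMap_mem hp hx ht)]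

theorem norm_pow_smul_le {t : ℝ} (ht : t ∈ Icc (0 : ℝ) 1) (m : ℕ) (v : G) : ‖t ^ m • v‖ ≤ ‖v‖ := by
  rw [norm_smul, norm_pow, Real.norm_of_nonneg ht.1]
  exact mul_le_of_le_one_left (norm_nonneg v) (pow_le_one₀ ht.1 ht.2)

theorem norm_integral_pow_smul_le {g : ℝ → G} {M : ℝ} (h : ∀ t ∈ Icc (0 : ℝ) 1, ‖g t‖ ≤ M)
    (m : ℕ) : ‖∫ t in (0 : ℝ)..1, t ^ m • g t‖ ≤ M := by
  have hbound : ∀ t ∈ uIoc (0 : ℝ) 1, ‖t ^ m • g t‖ ≤ M := fun t ht => by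
    rw [uIoc_of_le zero_le_one] at ht
    exact (norm_pow_smul_le (Ioc_subset_Icc_self ht) m _).trans (h t (Ioc_subset_Icc_self ht))
  simpa using intervalIntegral.norm_integral_le_of_norm_le_const hbound

theorem norm_coneAverage_le (hD : Convex ℝ D) (hp : p ∈ D) (hx : x ∈ D) {M : ℝ}
    (h : ∀ y ∈ D, ‖f y‖ ≤ M) (m : ℕ) : ‖coneAverage m p f x‖ ≤ M :=
  norm_integral_pow_smul_le (fun _ ht => h _ (hD.lineMap_mem hp hx ht)) m

theorem map_coneAverage {F : Type*} [NormedAddCommGroup F] [NormedSpace ℝ F]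
    [CompleteSpace G] [CompleteSpace F] (hD : Convex ℝ D) (hp : p ∈ D)
    (hx : x ∈ D) (hf : ContinuousOn f D) (m : ℕ) (L : G →L[ℝ] F) :
    L (coneAverage m p f x) = coneAverage m p (fun y => L (f y)) x := by
  rw [coneAverage, ← L.intervalIntegral_comp_comm
    (intervalIntegrable_coneAverage_integrand hD hp hx hf m)]
  simp only [coneAverage, map_smul]

theorem coneAverage_apply {F : Type*} [NormedAddCommGroup F] [NormedSpace ℝ F]
    {f : E → F →L[ℝ] G} (hD : Convex ℝ D) (hp : p ∈ D) (hx : x ∈ D)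
    (hf : ContinuousOn f D) (m : ℕ) (v : F) :
    coneAverage m p f x v = ∫ t in (0 : ℝ)..1, t ^ m • f (AffineMap.lineMap p x t) v := by
  rw [coneAverage, ContinuousLinearMap.intervalIntegral_apply
    (intervalIntegrable_coneAverage_integrand hD hp hx hf m)]
  simp only [smul_apply]

theorem exists_forall_norm_sub_sub_le_of_isCompact (hD : Convex ℝ D) (hc : IsCompact D)
    {f' : E → E →L[ℝ] G} (hf : ∀ y ∈ D, HasFDerivWithinAt f (f' y) D y)
    (hf' : ContinuousOn f' D) {ε : ℝ} (hε : 0 < ε) :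
    ∃ δ > 0, ∀ y ∈ D, ∀ z ∈ D, ‖z - y‖ ≤ δ → ‖f z - f y - f' y (z - y)‖ ≤ ε * ‖z - y‖ := by
  obtain ⟨δ, hδ, huc⟩ := Metric.uniformContinuousOn_iff_le.1
    (hc.uniformContinuousOn_of_continuous hf') ε hε
  refine ⟨δ, hδ, fun y hy z hz hzy => ?_⟩
  refine Convex.norm_image_sub_le_of_norm_hasFDerivWithin_le' (f' := f')
    (s := D ∩ Metric.closedBall y δ) (fun w hw => (hf w hw.1).mono inter_subset_left) ?_
    (hD.inter (convex_closedBall _ _)) ⟨hy, Metric.mem_closedBall_self hδ.le⟩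
    ⟨hz, mem_closedBall_iff_norm.2 hzy⟩
  intro w hw
  rw [← dist_eq_norm]
  exact huc w hw.1 y hy hw.2

theorem coneAverage_sub_coneAverage_sub (hD : Convex ℝ D) (hp : p ∈ D) {y : E} (hx : x ∈ D)
    (hy : y ∈ D) {f' : E → E →L[ℝ] G} (hf : ContinuousOn f D) (hf' : ContinuousOn f' D) (m : ℕ) :
    coneAverage m p f y - coneAverage m p f x - coneAverage (m + 1) p f' x (y - x) =
      ∫ t in (0 : ℝ)..1, t ^ m • (f (AffineMap.lineMap p y t) - f (AffineMap.lineMap p x t) -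
        f' (AffineMap.lineMap p x t)
          (AffineMap.lineMap p y t - AffineMap.lineMap p x t)) := by
  have hinty := intervalIntegrable_coneAverage_integrand hD hp hy hf m
  have hintx := intervalIntegrable_coneAverage_integrand hD hp hx hf m
  have hint' := intervalIntegrable_coneAverage_integrand (f := fun z => f' z (y - x)) hD hp hx
    (hf'.clm_apply continuousOn_const) (m + 1)
  rw [coneAverage_apply hD hp hx hf', coneAverage, coneAverage,
    ← intervalIntegral.integral_sub hinty hintx,
    ← intervalIntegral.integral_sub (hinty.sub hintx) hint']
  refine intervalIntegral.integral_congr fun t _ => ?_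
  simp only [lineMap_sub_lineMap_left, map_smul, pow_succ, mul_smul]
  rw [smul_sub, smul_sub]

theorem hasFDerivWithinAt_coneAverage (hD : Convex ℝ D) (hc : IsCompact D)
    (hp : p ∈ D) (hx : x ∈ D) {f' : E → E →L[ℝ] G}
    (hf : ∀ y ∈ D, HasFDerivWithinAt f (f' y) D y) (hf' : ContinuousOn f' D) (m : ℕ) :
    HasFDerivWithinAt (coneAverage m p f) (coneAverage (m + 1) p f' x) D x := by
  have hfc : ContinuousOn f D := fun y hy => (hf y hy).continuousWithinAt
  rw [hasFDerivWithinAt_iff_isLittleO, Asymptotics.isLittleO_iff]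
  intro ε hε
  obtain ⟨δ, hδ, htaylor⟩ := exists_forall_norm_sub_sub_le_of_isCompact hD hc hf hf' hε
  filter_upwards [self_mem_nhdsWithin,
    mem_nhdsWithin_of_mem_nhds (Metric.closedBall_mem_nhds x hδ)] with y hy hyx
  rw [mem_closedBall_iff_norm] at hyx
  rw [coneAverage_sub_coneAverage_sub hD hp hx hy hfc hf']
  refine norm_integral_pow_smul_le (fun t ht => ?_) m
  have hle : ‖(AffineMap.lineMap p y t : E) - AffineMap.lineMap p x t‖ ≤ ‖y - x‖ := by
    rw [lineMap_sub_lineMap_left]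
    simpa only [pow_one] using norm_pow_smul_le ht 1 (y - x)
  calc _ ≤ ε * ‖(AffineMap.lineMap p y t : E) - AffineMap.lineMap p x t‖ :=
        htaylor _ (hD.lineMap_mem hp hx ht) _ (hD.lineMap_mem hp hy ht) (hle.trans hyx)
    _ ≤ ε * ‖y - x‖ := by gcongr

theorem curryLeft_coneAverage [CompleteSpace G] (hD : Convex ℝ D) (hp : p ∈ D) (hx : x ∈ D)
    {k : ℕ} {f : E → E [×(k + 1)]→L[ℝ] G} (hf : ContinuousOn f D) (m : ℕ) :
    (coneAverage m p f x).curryLeft = coneAverage m p (fun y => (f y).curryLeft) x :=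
  map_coneAverage (F := E →L[ℝ] E [×k]→L[ℝ] G) hD hp hx hf m
    (continuousMultilinearCurryLeftEquiv ℝ (fun _ : Fin (k + 1) => E)
      G).toContinuousLinearEquiv.toContinuousLinearMap

theorem hasFTaylorSeriesUpToOn_coneAverage [CompleteSpace G] (hD : Convex ℝ D) (hc : IsCompact D)
    (hp : p ∈ D) {q : E → FormalMultilinearSeries ℝ E G}
    (hf : HasFTaylorSeriesUpToOn ∞ f q D) (m : ℕ) :
    HasFTaylorSeriesUpToOn ∞ (coneAverage m p f)
      (fun x k => coneAverage (m + k) p (fun y => q y k) x) D := by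
  have hcont (k : ℕ) : ContinuousOn (fun y => q y k) D := hf.cont k (mod_cast le_top)
  have hcurry (k : ℕ) : ContinuousOn (fun y => (q y (k + 1)).curryLeft) D :=
    (continuousMultilinearCurryLeftEquiv ℝ (fun _ : Fin (k + 1) => E)
      G).continuous.comp_continuousOn (hcont (k + 1))
  have hcone (k : ℕ) (x : E) (hx : x ∈ D) :
      HasFDerivWithinAt (coneAverage (m + k) p (fun y => q y k))
        (coneAverage (m + (k + 1)) p (fun y => q y (k + 1)) x).curryLeft D x := by
    rw [curryLeft_coneAverage hD hp hx (hcont (k + 1))]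
    exact hasFDerivWithinAt_coneAverage hD hc hp hx
      (hf.fderivWithin k (mod_cast WithTop.coe_lt_top k)) (hcurry k) (m + k)
  refine ⟨fun x hx => ?_, fun k _ => hcone k, fun k _ x hx => (hcone k x hx).continuousWithinAt⟩
  have hcurry0 := map_coneAverage hD hp hx (hcont 0) m
    (continuousMultilinearCurryFin0 ℝ E G).toContinuousLinearEquiv.toContinuousLinearMap
  exact hcurry0.trans (coneAverage_congr hD hp hx hf.zero_eq m)

theorem contDiffOn_coneAverage [CompleteSpace G] (hD : Convex ℝ D) (hc : IsCompact D)
    (hu : UniqueDiffOn ℝ D) (hp : p ∈ D) (hf : ContDiffOn ℝ ∞ f D) (m : ℕ) :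
    ContDiffOn ℝ ∞ (coneAverage m p f) D :=
  (hasFTaylorSeriesUpToOn_coneAverage hD hc hp (hf.ftaylorSeriesWithin hu) m).contDiffOn

theorem hasDerivAt_comp_lineMap (hD : Convex ℝ D) (hp : p ∈ D) (hx : x ∈ D)
    (hf : DifferentiableOn ℝ f D) {t : ℝ} (ht : t ∈ Ioo (0 : ℝ) 1) :
    HasDerivAt (fun t : ℝ => f (AffineMap.lineMap p x t))
      (fderivWithin ℝ f D (AffineMap.lineMap p x t) (x - p)) t := by
  have hfderiv := (hf _ (hD.lineMap_mem hp hx (Ioo_subset_Icc_self ht))).hasFDerivWithinAt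
  exact (hfderiv.comp_hasDerivWithinAt t AffineMap.hasDerivWithinAt_lineMap
    fun _ hs => hD.lineMap_mem hp hx hs).hasDerivAt (Icc_mem_nhds ht.1 ht.2)

/-- Integrating the derivative of `t ↦ tᵐ f(p + t (x - p))`. For `m = 0` the truncated exponent
`m - 1` is harmless, as its term has coefficient `0`. -/
theorem coneAverage_fderivWithin_apply_add [CompleteSpace G] (hD : Convex ℝ D)
    (hp : p ∈ D) (hx : x ∈ D) (hf : DifferentiableOn ℝ f D)
    (hf' : ContinuousOn (fderivWithin ℝ f D) D) (m : ℕ) :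
    coneAverage m p (fderivWithin ℝ f D) x (x - p) + (m : ℝ) • coneAverage (m - 1) p f x =
      f x - (0 : ℝ) ^ m • f p := by
  have hint' := intervalIntegrable_coneAverage_integrand
    (f := fun y => fderivWithin ℝ f D y (x - p)) hD hp hx (hf'.clm_apply continuousOn_const) m
  have hint : IntervalIntegrable
      (fun t : ℝ => (m : ℝ) • t ^ (m - 1) • f (AffineMap.lineMap p x t)) MeasureTheory.volume 0 1 :=
    (intervalIntegrable_coneAverage_integrand hD hp hx hf.continuousOn (m - 1)).smul (m : ℝ)
  have hderiv : ∀ t ∈ Ioo (0 : ℝ) 1, HasDerivAt (fun t : ℝ => t ^ m • f (AffineMap.lineMap p x t))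
      (t ^ m • fderivWithin ℝ f D (AffineMap.lineMap p x t) (x - p) +
        (m : ℝ) • t ^ (m - 1) • f (AffineMap.lineMap p x t)) t := fun t ht => by
    have h := (hasDerivAt_pow m t).smul (hasDerivAt_comp_lineMap hD hp hx hf ht)
    rwa [mul_smul] at h
  have hftc := intervalIntegral.integral_eq_sub_of_hasDerivAt_of_le zero_le_one
    (continuousOn_coneAverage_integrand hD hp hx hf.continuousOn m) hderiv (hint'.add hint)
  rw [coneAverage_apply hD hp hx hf', coneAverage, ← intervalIntegral.integral_smul,
    ← intervalIntegral.integral_add hint' hint, hftc]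
  simp only [AffineMap.lineMap_apply_one, AffineMap.lineMap_apply_zero, one_pow, one_smul]

end ConeAverage

/-! ### The cone operator on forms -/

section ConeForm

open ContinuousAlternatingMap

variable {E G : Type*} [NormedAddCommGroup E] [NormedSpace ℝ E] [NormedAddCommGroup G]
  [NormedSpace ℝ G] {D : Set E} {p x : E} {m : ℕ}

/-- Currying the first argument of a form, as a continuous linear map. -/
def curryCLM (E G : Type*) [NormedAddCommGroup E] [NormedSpace ℝ E] [NormedAddCommGroup G]
    [NormedSpace ℝ G] (n : ℕ) : (E [⋀^Fin (n + 1)]→L[ℝ] G) →L[ℝ] E →L[ℝ] (E [⋀^Fin n]→L[ℝ] G) :=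
  (curryLeftLI (𝕜 := ℝ)).toContinuousLinearMap

theorem contDiff_curryCLM (n : ℕ) : ContDiff ℝ ∞ (curryCLM E G n) := by
  apply ContinuousLinearMap.contDiff

/-- Contraction of forms with a fixed vector, as a continuous linear map. -/
def contractCLM (n : ℕ) (X : E) : (E [⋀^Fin (n + 1)]→L[ℝ] G) →L[ℝ] (E [⋀^Fin n]→L[ℝ] G) :=
  (ContinuousLinearMap.apply ℝ _ X).comp (curryCLM E G n)

theorem contractCLM_apply (X : E) (g : E [⋀^Fin (m + 1)]→L[ℝ] G) :
    contractCLM m X g = g.curryLeft X := rfl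

theorem succ_removeNth_vecCons {α : Type*} (a : α) (w : Fin (m + 1) → α) (i : Fin (m + 1)) :
    i.succ.removeNth (Matrix.vecCons a w) = Matrix.vecCons a (i.removeNth w) := by
  ext j
  refine Fin.cases ?_ (fun j => ?_) j <;> simp [Fin.removeNth]

/-- The algebraic form of Cartan's formula. -/
theorem alternatizeUncurryFin_contract_add (B : E →L[ℝ] E [⋀^Fin (m + 1)]→L[ℝ] G) (X : E) :
    alternatizeUncurryFin ((contractCLM m X).comp B) +
      (alternatizeUncurryFin B).curryLeft X = B X := by
  ext w
  have hzero : (0 : Fin (m + 2)).removeNth (Matrix.vecCons X w) = w := rfl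
  simp only [ContinuousAlternatingMap.add_apply, curryLeft_apply_apply, alternatizeUncurryFin_apply,
    ContinuousLinearMap.comp_apply, contractCLM_apply]
  rw [Fin.sum_univ_succ (n := m + 1), hzero]
  simp [succ_removeNth_vecCons, pow_succ]

/-- The cone operator on forms, with apex `p`: the pullback under the homotopy
`(t, x) ↦ p + t (x - p)`, integrated over the fibre `t ∈ [0, 1]`. -/
def coneForm (p : E) (f : E → E [⋀^Fin (m + 1)]→L[ℝ] G) (x : E) : E [⋀^Fin m]→L[ℝ] G :=
  (coneAverage m p f x).curryLeft (x - p)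

theorem contDiffOn_coneForm [CompleteSpace G] {f : E → E [⋀^Fin (m + 1)]→L[ℝ] G}
    (hD : Convex ℝ D) (hc : IsCompact D) (hu : UniqueDiffOn ℝ D) (hp : p ∈ D)
    (hf : ContDiffOn ℝ ∞ f D) : ContDiffOn ℝ ∞ (coneForm p f) D :=
  ((contDiff_curryCLM m).comp_contDiffOn
    (contDiffOn_coneAverage hD hc hu hp hf m)).clm_apply (contDiffOn_id.sub contDiffOn_const)

theorem norm_coneForm_le {f : E → E [⋀^Fin (m + 1)]→L[ℝ] G} (hD : Convex ℝ D) (hp : p ∈ D)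
    (hx : x ∈ D) {M : ℝ} (h : ∀ y ∈ D, ‖f y‖ ≤ M) : ‖coneForm p f x‖ ≤ M * ‖x - p‖ := by
  refine ((coneAverage m p f x).curryLeft.le_opNorm (x - p)).trans ?_
  rw [norm_curryLeft]
  gcongr
  exact norm_coneAverage_le hD hp hx h m

theorem coneAverage_extDerivWithin [CompleteSpace G] {f : E → E [⋀^Fin m]→L[ℝ] G}
    (hD : Convex ℝ D) (hp : p ∈ D) (hx : x ∈ D) (hf' : ContinuousOn (fderivWithin ℝ f D) D)
    (l : ℕ) : coneAverage l p (extDerivWithin f D) x =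
      alternatizeUncurryFin (coneAverage l p (fderivWithin ℝ f D) x) :=
  (map_coneAverage (G := E →L[ℝ] E [⋀^Fin m]→L[ℝ] G) (F := E [⋀^Fin (m + 1)]→L[ℝ] G)
    hD hp hx hf' l (alternatizeUncurryFinCLM ℝ E G)).symm

theorem hasFDerivWithinAt_apply_sub {F : Type*} [NormedAddCommGroup F] [NormedSpace ℝ F]
    (C : F →L[ℝ] E →L[ℝ] G) (p : E) {h : E → F} {h' : E →L[ℝ] F}
    (hh : HasFDerivWithinAt h h' D x) :
    HasFDerivWithinAt (fun y => C (h y) (y - p))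
      (((ContinuousLinearMap.apply ℝ G (x - p)).comp C).comp h' + C (h x)) D x := by
  refine (((C.hasFDerivAt (x := h x)).comp_hasFDerivWithinAt x hh).clm_apply
    ((hasFDerivWithinAt_id x D).sub_const p)).congr_fderiv ?_
  ext e
  simp [add_comm]

theorem hasFDerivWithinAt_coneForm {f : E → E [⋀^Fin (m + 1)]→L[ℝ] G} (hD : Convex ℝ D)
    (hc : IsCompact D) (hp : p ∈ D) (hx : x ∈ D) (hf : DifferentiableOn ℝ f D)
    (hf' : ContinuousOn (fderivWithin ℝ f D) D) :
    HasFDerivWithinAt (coneForm p f)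
      ((contractCLM m (x - p)).comp (coneAverage (m + 1) p (fderivWithin ℝ f D) x) +
        (coneAverage m p f x).curryLeft) D x := by
  have haverage := hasFDerivWithinAt_coneAverage hD hc hp hx
    (fun y hy => (hf y hy).hasFDerivWithinAt) hf' m
  exact hasFDerivWithinAt_apply_sub (curryCLM E G m) p haverage

theorem extDerivWithin_coneForm_add [CompleteSpace G] {f : E → E [⋀^Fin (m + 1)]→L[ℝ] G}
    (hD : Convex ℝ D) (hc : IsCompact D) (hu : UniqueDiffOn ℝ D) (hp : p ∈ D) (hx : x ∈ D)
    (hf : DifferentiableOn ℝ f D) (hf' : ContinuousOn (fderivWithin ℝ f D) D) :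
    extDerivWithin (coneForm p f) D x + coneForm p (extDerivWithin f D) x = f x := by
  have hradial := coneAverage_fderivWithin_apply_add hD hp hx hf hf' (m + 1)
  rw [zero_pow m.succ_ne_zero, zero_smul, sub_zero] at hradial
  rw [extDerivWithin, (hasFDerivWithinAt_coneForm hD hc hp hx hf hf').fderivWithin (hu x hx),
    coneForm, coneAverage_extDerivWithin hD hp hx hf', alternatizeUncurryFin_add,
    alternatizeUncurryFin_curryLeft, add_right_comm, alternatizeUncurryFin_contract_add,
    ← Nat.cast_smul_eq_nsmul ℝ]
  exact hradial

theorem coneForm_extDerivWithin_zero [CompleteSpace G] {f : E → E [⋀^Fin 0]→L[ℝ] G}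
    (hD : Convex ℝ D) (hp : p ∈ D) (hx : x ∈ D) (hf : DifferentiableOn ℝ f D)
    (hf' : ContinuousOn (fderivWithin ℝ f D) D) :
    coneForm p (extDerivWithin f D) x = f x - f p := by
  have hradial := coneAverage_fderivWithin_apply_add hD hp hx hf hf' 0
  rw [Nat.cast_zero, zero_smul, add_zero, pow_zero, one_smul] at hradial
  rw [coneForm, coneAverage_extDerivWithin hD hp hx hf', ← hradial]
  ext w
  simp [alternatizeUncurryFin_apply]

end ConeForm

section ExtDerivWithin

open ContinuousAlternatingMap

variable {E F G : Type*} [NormedAddCommGroup E] [NormedSpace ℝ E] [NormedAddCommGroup F]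
  [NormedSpace ℝ F] [NormedAddCommGroup G] [NormedSpace ℝ G] {D : Set E} {x : E} {k : ℕ}

theorem contDiffOn_extDerivWithin {f : E → E [⋀^Fin k]→L[ℝ] G} (hu : UniqueDiffOn ℝ D)
    (hf : ContDiffOn ℝ ∞ f D) : ContDiffOn ℝ ∞ (extDerivWithin f D) D := by
  have halternatize : ContDiff ℝ ∞ (alternatizeUncurryFinCLM (n := k) ℝ E G) := by
    apply ContinuousLinearMap.contDiff
  exact halternatize.comp_contDiffOn ((contDiffOn_infty_iff_fderivWithin hu).1 hf).2

theorem minSmoothness_two_le_infty : minSmoothness ℝ 2 ≤ (∞ : WithTop ℕ∞) := by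
  rw [minSmoothness_of_isRCLikeNormedField]
  exact WithTop.coe_le_coe.2 le_top

theorem extDerivWithin_comp_affine {f : F → F [⋀^Fin k]→L[ℝ] G} (L : E →L[ℝ] F) (c : F)
    {T : Set F} (hf : DifferentiableWithinAt ℝ f T (L x + c)) (hu : UniqueDiffOn ℝ D)
    (hxc : x ∈ closure (interior D)) (hx : x ∈ D) (hDT : MapsTo (fun y => L y + c) D T) :
    extDerivWithin (fun y => (f (L y + c)).compContinuousLinearMap L) D x =
      (extDerivWithin f T (L x + c)).compContinuousLinearMap L := by
  have hfderiv : EqOn (fderivWithin ℝ (fun y => L y + c) D) (fun _ => L) D := fun y hy =>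
    (L.hasFDerivAt.add_const c).hasFDerivWithinAt.fderivWithin (hu y hy)
  have hφ : ContDiffWithinAt ℝ ∞ (fun y => L y + c) D x := by fun_prop
  have h := extDerivWithin_pullback (f := fun y => L y + c) hf hφ minSmoothness_two_le_infty hu hxc
    hx hDT
  rw [hfderiv hx] at h
  rw [← h]
  exact extDerivWithin_congr' (fun y hy => by simp only [hfderiv hy]) hx

theorem extDerivWithin_extDerivWithin_eq_zero {f : E → E [⋀^Fin k]→L[ℝ] G}
    (hu : UniqueDiffOn ℝ D) (hf : ContDiffOn ℝ ∞ f D) (hxc : x ∈ closure (interior D))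
    (hx : x ∈ D) : extDerivWithin (extDerivWithin f D) D x = 0 :=
  extDerivWithin_extDerivWithin_apply (hf x hx) minSmoothness_two_le_infty hu hxc hx

theorem norm_extDerivWithin_smul_le {c : E → ℝ} {f : E → E [⋀^Fin k]→L[ℝ] G}
    (hu : UniqueDiffWithinAt ℝ D x) (hc : DifferentiableWithinAt ℝ c D x)
    (hf : DifferentiableWithinAt ℝ f D x) :
    ‖extDerivWithin (fun y => c y • f y) D x‖ ≤
      |c x| * ‖extDerivWithin f D x‖ + (k + 1) * (‖fderivWithin ℝ c D x‖ * ‖f x‖) := by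
  rw [extDerivWithin, fderivWithin_fun_smul hu hc hf, alternatizeUncurryFin_add,
    alternatizeUncurryFin_smul]
  refine (norm_add_le _ _).trans (add_le_add (norm_smul _ _).le ?_)
  refine (norm_alternatizeUncurryFin_le _).trans ?_
  rw [ContinuousLinearMap.norm_smulRight_apply]

end ExtDerivWithin

/-! ### Faces, simplicial maps and charts -/

section Geometry

variable {V : Type*} [Fintype V] {s t : Finset V} {x y : EuclideanSpace ℝ V}

theorem closedSimplex_mono (h : t ⊆ s) : closedSimplex t ⊆ closedSimplex s :=
  fun _ hx => ⟨hx.1, fun i hi => hx.2.1 i fun hit => hi (h hit), hx.2.2⟩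

theorem nonempty_of_mem_closedSimplex (hx : x ∈ closedSimplex s) : s.Nonempty := by
  by_contra h
  rw [Finset.not_nonempty_iff_eq_empty] at h
  have hsum : ∑ i, x i = 0 := Finset.sum_eq_zero fun i _ => hx.2.1 i (by simp [h])
  exact zero_ne_one (hsum.symm.trans hx.2.2)

theorem le_one_of_mem_closedSimplex (hx : x ∈ closedSimplex s) (i : V) : x i ≤ 1 :=
  hx.2.2 ▸ Finset.single_le_sum (fun j _ => hx.1 j) (Finset.mem_univ i)

theorem abs_le_one_of_mem_closedSimplex (hx : x ∈ closedSimplex s) (i : V) : |x i| ≤ 1 :=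
  (abs_of_nonneg (hx.1 i)).le.trans (le_one_of_mem_closedSimplex hx i)

theorem norm_le_one_of_mem_closedSimplex (hx : x ∈ closedSimplex s) : ‖x‖ ≤ 1 := by
  rw [← sq_le_one_iff₀ (norm_nonneg x), EuclideanSpace.norm_sq_eq, ← hx.2.2]
  refine Finset.sum_le_sum fun i _ => ?_
  rw [Real.norm_of_nonneg (hx.1 i), sq]
  exact mul_le_of_le_one_left (hx.1 i) (le_one_of_mem_closedSimplex hx i)

theorem convex_closedSimplex (s : Finset V) : Convex ℝ (closedSimplex s) := by
  intro x hx y hy a b ha hb hab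
  refine ⟨fun i => ?_, fun i hi => ?_, ?_⟩
  · simpa using add_nonneg (mul_nonneg ha (hx.1 i)) (mul_nonneg hb (hy.1 i))
  · simp [hx.2.1 i hi, hy.2.1 i hi]
  · simp [Finset.sum_add_distrib, ← Finset.mul_sum, hx.2.2, hy.2.2, hab]

theorem isClosed_closedSimplex (s : Finset V) : IsClosed (closedSimplex s) := by
  have hinter : closedSimplex s = (⋂ i, {x : EuclideanSpace ℝ V | 0 ≤ x i}) ∩
      ((⋂ i, ⋂ (_ : i ∉ s), {x | x i = 0}) ∩ {x | ∑ i, x i = 1}) := by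
    ext x; simp [closedSimplex]
  rw [hinter]
  exact (isClosed_iInter fun i => isClosed_le continuous_const (by fun_prop)).inter
    ((isClosed_iInter fun i => isClosed_iInter fun _ =>
      isClosed_eq (by fun_prop) continuous_const).inter
      (isClosed_eq (by fun_prop) continuous_const))

theorem isCompact_closedSimplex (s : Finset V) : IsCompact (closedSimplex s) :=
  (isCompact_closedBall (0 : EuclideanSpace ℝ V) 1).of_isClosed_subset (isClosed_closedSimplex s)
    fun _ hx => mem_closedBall_zero_iff.2 (norm_le_one_of_mem_closedSimplex hx)

/-- The orthogonal projection to the tangent space of a simplex. -/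
def tangentProj (s : Finset V) : EuclideanSpace ℝ V →L[ℝ] simplexDir s :=
  (simplexDir s).orthogonalProjectionOnto

theorem tangentProj_coe (v : simplexDir s) : tangentProj s v = v :=
  (simplexDir s).orthogonalProjectionOnto_mem_subspace_eq_self v

theorem coe_tangentProj {v : EuclideanSpace ℝ V} (hv : v ∈ simplexDir s) :
    (tangentProj s v : EuclideanSpace ℝ V) = v :=
  congrArg Subtype.val (tangentProj_coe (⟨v, hv⟩ : simplexDir s))

theorem sub_mem_simplexDir (hx : x ∈ closedSimplex s) (hy : y ∈ closedSimplex s) :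
    x - y ∈ simplexDir s :=
  ⟨fun i hi => by simp [hx.2.1 i hi, hy.2.1 i hi], by
    simp [Finset.sum_sub_distrib, hx.2.2, hy.2.2]⟩

/-- A linear map of `ℝ^V` that takes the simplex spanned by `t` into the one spanned by `s`;
forms can be pulled back along it. -/
structure IsSimplexMap (L : EuclideanSpace ℝ V →L[ℝ] EuclideanSpace ℝ V) (t s : Finset V) :
    Prop where
  mapsTo : MapsTo L (closedSimplex t) (closedSimplex s)
  map_dir : ∀ v ∈ simplexDir t, L v ∈ simplexDir s

theorem isSimplexMap_id (h : t ⊆ s) : IsSimplexMap (ContinuousLinearMap.id ℝ _) t s :=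
  ⟨fun _ hx => closedSimplex_mono h hx, fun _ hv => simplexDir_mono h hv⟩

namespace IsSimplexMap

variable {L : EuclideanSpace ℝ V →L[ℝ] EuclideanSpace ℝ V}

/-- The derivative of a map of simplices. -/
def dirMap (hL : IsSimplexMap L t s) : simplexDir t →L[ℝ] simplexDir s :=
  (L.comp (simplexDir t).subtypeL).codRestrict (simplexDir s) fun v => hL.map_dir v v.2

theorem coe_dirMap (hL : IsSimplexMap L t s) (v : simplexDir t) :
    (hL.dirMap v : EuclideanSpace ℝ V) = L v := rfl

theorem norm_dirMap_le (hL : IsSimplexMap L t s) : ‖hL.dirMap‖ ≤ ‖L‖ :=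
  ContinuousLinearMap.opNorm_le_bound _ (norm_nonneg L) fun v => L.le_opNorm v

end IsSimplexMap

end Geometry

section Charts

theorem barycenter_apply {V : Type*} [DecidableEq V] (s : Finset V) (i : V) :
    barycenter s i = if i ∈ s then (s.card : ℝ)⁻¹ else 0 := by
  simp [barycenter, Finset.sum_apply, Pi.single_apply]

variable {V : Type*} [Fintype V] [DecidableEq V] {s t : Finset V} {x : EuclideanSpace ℝ V}

theorem single_mem_closedSimplex {i : V} (hi : i ∈ s) :
    EuclideanSpace.single i (1 : ℝ) ∈ closedSimplex s := by
  refine ⟨fun j => ?_, fun j hj => ?_, by simp⟩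
  · by_cases h : j = i <;> simp [h]
  · simp [show j ≠ i from fun h => hj (h ▸ hi)]

theorem barycenter_mem_closedSimplex (hs : s.Nonempty) : barycenter s ∈ closedSimplex s := by
  refine ⟨fun i => ?_, fun i hi => by simp [barycenter_apply, hi], ?_⟩
  · rw [barycenter_apply]; positivity
  · simp only [barycenter_apply, Finset.sum_ite_mem, Finset.univ_inter, Finset.sum_const,
      nsmul_eq_mul]
    exact mul_inv_cancel₀ (by exact_mod_cast hs.card_pos.ne')

/-- The coordinate of a point in the chart of a simplex. -/
def unchart (s : Finset V) (x : EuclideanSpace ℝ V) : simplexDir s :=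
  tangentProj s (x - barycenter s)

theorem unchart_chart (v : simplexDir s) : unchart s (chart s v) = v := by
  simp [unchart, chart, tangentProj_coe]

theorem chart_unchart (hx : x ∈ closedSimplex s) : chart s (unchart s x) = x := by
  rw [chart, unchart, coe_tangentProj (sub_mem_simplexDir hx
    (barycenter_mem_closedSimplex (nonempty_of_mem_closedSimplex hx))), add_sub_cancel]

theorem unchart_mem (hx : x ∈ closedSimplex s) : unchart s x ∈ chartDomain s := by
  rw [chartDomain, mem_ofPred_eq, chart_unchart hx]
  exact hx

theorem continuous_unchart (s : Finset V) : Continuous (unchart s) :=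
  (tangentProj s).continuous.comp (continuous_id.sub continuous_const)

theorem chart_lineMap (s : Finset V) (v w : simplexDir s) (r : ℝ) :
    chart s (AffineMap.lineMap v w r) = AffineMap.lineMap (chart s v) (chart s w) r := by
  simp only [chart, AffineMap.lineMap_apply_module', Submodule.coe_add, Submodule.coe_smul,
    Submodule.coe_sub, add_sub_add_left_eq_sub]
  abel

theorem chartDomain_eq_image (s : Finset V) : chartDomain s = unchart s '' closedSimplex s := by
  ext v
  refine ⟨fun hv => ⟨chart s v, hv, unchart_chart v⟩, ?_⟩
  rintro ⟨x, hx, rfl⟩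
  exact unchart_mem hx

theorem isCompact_chartDomain (s : Finset V) : IsCompact (chartDomain s) := by
  rw [chartDomain_eq_image]
  exact (isCompact_closedSimplex s).image (continuous_unchart s)

theorem convex_chartDomain (s : Finset V) : Convex ℝ (chartDomain s) := by
  rw [convex_iff_segment_subset]
  intro v hv w hw
  rw [segment_eq_image_lineMap]
  rintro _ ⟨r, hr, rfl⟩
  rw [chartDomain, mem_ofPred_eq, chart_lineMap]
  exact (convex_closedSimplex s).lineMap_mem hv hw hr

theorem chart_mem_closedSimplex_of_nonneg (hs : s.Nonempty) {v : simplexDir s}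
    (hv : ∀ i ∈ s, 0 ≤ chart s v i) : chart s v ∈ closedSimplex s := by
  have hb := barycenter_mem_closedSimplex hs
  have hout : ∀ i ∉ s, chart s v i = 0 := fun i hi => by simp [chart, hb.2.1 i hi, v.2.1 i hi]
  refine ⟨fun i => ?_, hout, by simp [chart, Finset.sum_add_distrib, hb.2.2, v.2.2]⟩
  by_cases hi : i ∈ s
  exacts [hv i hi, (hout i hi).ge]

theorem interior_chartDomain_nonempty (hs : s.Nonempty) : (interior (chartDomain s)).Nonempty := by
  refine ⟨0, mem_interior.2 ⟨⋂ i : s, {v : simplexDir s | 0 < barycenter s i + v.1 i}, ?_, ?_, ?_⟩⟩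
  · intro v hv
    rw [mem_iInter] at hv
    exact chart_mem_closedSimplex_of_nonneg hs fun i hi => (hv ⟨i, hi⟩).le
  · exact isOpen_iInter_of_finite fun i => isOpen_lt continuous_const (by fun_prop)
  · refine mem_iInter.2 fun i => ?_
    have hcard : (0 : ℝ) < s.card := by exact_mod_cast hs.card_pos
    simp [barycenter_apply, hcard]

theorem uniqueDiffOn_chartDomain (s : Finset V) : UniqueDiffOn ℝ (chartDomain s) := by
  intro v hv
  exact uniqueDiffOn_convex (convex_chartDomain s)
    (interior_chartDomain_nonempty (nonempty_of_mem_closedSimplex hv)) v hv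

theorem subset_closure_interior_chartDomain (s : Finset V) :
    chartDomain s ⊆ closure (interior (chartDomain s)) := by
  intro v hv
  rw [(convex_chartDomain s).closure_interior_eq_closure_of_nonempty_interior
    (interior_chartDomain_nonempty (nonempty_of_mem_closedSimplex hv))]
  exact subset_closure hv

namespace IsSimplexMap

variable {L : EuclideanSpace ℝ V →L[ℝ] EuclideanSpace ℝ V}

theorem unchart_map_chart (hL : IsSimplexMap L t s) (v : simplexDir t) :
    unchart s (L (chart t v)) = hL.dirMap v + unchart s (L (barycenter t)) := by
  have hdir : tangentProj s (L v) = hL.dirMap v := tangentProj_coe (hL.dirMap v)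
  rw [unchart, unchart, chart, map_add, add_comm, add_sub_assoc, map_add, hdir]

theorem chart_dirMap_add (hL : IsSimplexMap L t s) {v : simplexDir t} (hv : v ∈ chartDomain t) :
    chart s (hL.dirMap v + unchart s (L (barycenter t))) = L (chart t v) := by
  rw [← unchart_map_chart, chart_unchart (hL.mapsTo hv)]

theorem mapsTo_chartDomain (hL : IsSimplexMap L t s) :
    MapsTo (fun v => hL.dirMap v + unchart s (L (barycenter t))) (chartDomain t) (chartDomain s) :=
  fun v hv => by simpa only [← hL.unchart_map_chart] using unchart_mem (hL.mapsTo hv)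

end IsSimplexMap

end Charts

/-! ### Forms on one simplex -/

section LocalForms

variable {V : Type*} [Fintype V] {s t : Finset V} {k : ℕ} {x : EuclideanSpace ℝ V}

-- Found by instance search for an abstract normed space, but not for the subspace `simplexDir s`.
instance : NormSMulClass ℝ (simplexDir s [⋀^Fin k]→L[ℝ] ℝ) :=
  NormedSpace.toNormSMulClass (𝕜 := ℝ) (E := simplexDir s [⋀^Fin k]→L[ℝ] ℝ)

/-- A form on the simplex spanned by `s`; only its values on the simplex are meaningful. -/
abbrev LocalForm (s : Finset V) (k : ℕ) :=
  EuclideanSpace ℝ V → simplexDir s [⋀^Fin k]→L[ℝ] ℝ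

namespace LocalForm

variable {L : EuclideanSpace ℝ V →L[ℝ] EuclideanSpace ℝ V}

/-- The pullback of a form under a map of simplices. -/
def pullback (hL : IsSimplexMap L t s) (f : LocalForm s k) : LocalForm t k := fun x =>
  (f (L x)).compContinuousLinearMap hL.dirMap

theorem pullback_apply_eq_zero (hL : IsSimplexMap L t s) {f : LocalForm s k} (hf : f (L x) = 0) :
    pullback hL f x = 0 := by
  rw [pullback, hf]
  rfl

theorem norm_pullback_le (hL : IsSimplexMap L t s) (f : LocalForm s k)
    (x : EuclideanSpace ℝ V) : ‖pullback hL f x‖ ≤ ‖L‖ ^ k * ‖f (L x)‖ := by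
  refine ((f (L x)).norm_compContinuousLinearMap_le hL.dirMap).trans ?_
  rw [Fintype.card_fin, mul_comm]
  gcongr
  exact hL.norm_dirMap_le

/-- The restriction of a form to a face. -/
def faceRes (h : t ⊆ s) (f : LocalForm s k) : LocalForm t k :=
  pullback (isSimplexMap_id h) f

theorem faceRes_add (h : t ⊆ s) (f g : LocalForm s k) :
    faceRes h (f + g) = faceRes h f + faceRes h g := rfl

theorem faceRes_sub (h : t ⊆ s) (f g : LocalForm s k) :
    faceRes h (f - g) = faceRes h f - faceRes h g := rfl

theorem norm_faceRes_le (h : t ⊆ s) (f : LocalForm s k) (x : EuclideanSpace ℝ V) :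
    ‖faceRes h f x‖ ≤ ‖f x‖ := by
  refine (norm_pullback_le _ f x).trans (mul_le_of_le_one_left (norm_nonneg (f x)) ?_)
  exact pow_le_one₀ (norm_nonneg _) ContinuousLinearMap.norm_id_le

theorem faceRes_congr (h : t ⊆ s) {f g : LocalForm s k} (hfg : EqOn f g (closedSimplex t)) :
    EqOn (faceRes h f) (faceRes h g) (closedSimplex t) := fun _ hx =>
  congrArg (·.compContinuousLinearMap (isSimplexMap_id h).dirMap) (hfg hx)

/-- The comass of the form is at most `M` at every point of the simplex. -/
def BoundedBy (f : LocalForm s k) (M : ℝ) : Prop :=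
  ∀ x ∈ closedSimplex s, ‖f x‖ ≤ M

namespace BoundedBy

variable {f g : LocalForm s k} {M N : ℝ}

theorem nonneg (hf : BoundedBy f M) (hx : x ∈ closedSimplex s) : 0 ≤ M :=
  (norm_nonneg (f x)).trans (hf x hx)

theorem zero : BoundedBy (0 : LocalForm s k) 0 := fun _ _ =>
  (norm_zero (E := simplexDir s [⋀^Fin k]→L[ℝ] ℝ)).le

theorem mono (hf : BoundedBy f M) (h : M ≤ N) : BoundedBy f N := fun x hx => (hf x hx).trans h

theorem congr (hf : BoundedBy f M) (h : EqOn g f (closedSimplex s)) : BoundedBy g M :=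
  fun x hx => (h hx) ▸ hf x hx

theorem add (hf : BoundedBy f M) (hg : BoundedBy g N) : BoundedBy (f + g) (M + N) :=
  fun x hx => (norm_add_le (f x) (g x)).trans (add_le_add (hf x hx) (hg x hx))

theorem sub (hf : BoundedBy f M) (hg : BoundedBy g N) : BoundedBy (f - g) (M + N) :=
  fun x hx => (norm_sub_le (f x) (g x)).trans (add_le_add (hf x hx) (hg x hx))

theorem faceRes (hf : BoundedBy f M) (h : t ⊆ s) : BoundedBy (faceRes h f) M :=
  fun x hx => (norm_faceRes_le h f x).trans (hf x (closedSimplex_mono h hx))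

end BoundedBy

variable [DecidableEq V]

/-- Smoothness up to the boundary. -/
def IsSmooth (f : LocalForm s k) : Prop :=
  ContDiffOn ℝ ∞ (fun v => f (chart s v)) (chartDomain s)

/-- The exterior derivative on a simplex. -/
def extD (f : LocalForm s k) : LocalForm s (k + 1) := fun x =>
  extDerivWithin (fun v => f (chart s v)) (chartDomain s) (unchart s x)

namespace IsSmooth

variable {f g : LocalForm s k}

theorem zero : IsSmooth (0 : LocalForm s k) := contDiffOn_const

theorem add (hf : IsSmooth f) (hg : IsSmooth g) : IsSmooth (f + g) := ContDiffOn.add hf hg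

theorem sub (hf : IsSmooth f) (hg : IsSmooth g) : IsSmooth (f - g) := ContDiffOn.sub hf hg

theorem const_smul (c : ℝ) (hf : IsSmooth f) : IsSmooth (c • f) :=
  ContDiffOn.const_smul c hf

theorem differentiableOn (hf : IsSmooth f) :
    DifferentiableOn ℝ (fun v => f (chart s v)) (chartDomain s) :=
  ContDiffOn.differentiableOn hf (by simp)

theorem continuousOn (hf : IsSmooth f) : ContinuousOn f (closedSimplex s) := by
  refine (ContinuousOn.comp (ContDiffOn.continuousOn hf) (continuous_unchart s).continuousOn
    fun x (hx : x ∈ closedSimplex s) => unchart_mem hx).congr fun x hx => ?_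
  simp only [Function.comp_apply, chart_unchart hx]

theorem extD (hf : IsSmooth f) : IsSmooth (extD f) := by
  refine (contDiffOn_extDerivWithin (uniqueDiffOn_chartDomain s) hf).congr fun v _ => ?_
  simp only [LocalForm.extD, unchart_chart]

theorem pullback (hf : IsSmooth f) (hL : IsSimplexMap L t s) : IsSmooth (pullback hL f) := by
  have hcomp : ContDiffOn ℝ ∞ (fun v => f (L (chart t v))) (chartDomain t) := by
    refine (ContDiffOn.comp hf ?_ hL.mapsTo_chartDomain).congr fun v hv => ?_
    · fun_prop
    · simp only [Function.comp_apply, hL.chart_dirMap_add hv]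
  have hpull : ContDiff ℝ ∞ (ContinuousAlternatingMap.compContinuousLinearMapCLM hL.dirMap :
      (simplexDir s [⋀^Fin k]→L[ℝ] ℝ) →L[ℝ] simplexDir t [⋀^Fin k]→L[ℝ] ℝ) := by
    apply ContinuousLinearMap.contDiff
  exact hpull.comp_contDiffOn hcomp

theorem faceRes (hf : IsSmooth f) (h : t ⊆ s) : IsSmooth (faceRes h f) := hf.pullback _

end IsSmooth

variable {f g : LocalForm s k}

theorem extD_congr (h : EqOn f g (closedSimplex s)) (hx : x ∈ closedSimplex s) :
    extD f x = extD g x :=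
  extDerivWithin_congr' (fun _ hv => h hv) (unchart_mem hx)

theorem extD_eq_zero (h : EqOn f 0 (closedSimplex s)) (hx : x ∈ closedSimplex s) :
    extD f x = 0 := by
  rw [extD_congr h hx]
  ext w
  simp [extD, extDerivWithin, ContinuousAlternatingMap.alternatizeUncurryFin_apply]

theorem extD_add (hf : IsSmooth f) (hg : IsSmooth g) (hx : x ∈ closedSimplex s) :
    extD (f + g) x = extD f x + extD g x :=
  extDerivWithin_add (uniqueDiffOn_chartDomain s _ (unchart_mem hx))
    (hf.differentiableOn _ (unchart_mem hx)) (hg.differentiableOn _ (unchart_mem hx))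

theorem extD_const_smul (c : ℝ) (f : LocalForm s k) (hx : x ∈ closedSimplex s) :
    extD (c • f) x = c • extD f x :=
  extDerivWithin_smul c _ (uniqueDiffOn_chartDomain s _ (unchart_mem hx))

theorem extD_sub (hf : IsSmooth f) (hg : IsSmooth g) (hx : x ∈ closedSimplex s) :
    extD (f - g) x = extD f x - extD g x := by
  rw [eq_sub_iff_add_eq, ← extD_add (hf.sub hg) hg hx, sub_add_cancel]

theorem extD_extD (hf : IsSmooth f) (hx : x ∈ closedSimplex s) : extD (extD f) x = 0 := by
  have h := extDerivWithin_extDerivWithin_eq_zero (uniqueDiffOn_chartDomain s) hf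
    (subset_closure_interior_chartDomain s (unchart_mem hx)) (unchart_mem hx)
  simpa only [extD, unchart_chart] using h

theorem extD_pullback (hf : IsSmooth f) (hL : IsSimplexMap L t s) (hx : x ∈ closedSimplex t) :
    extD (pullback hL f) x = pullback hL (extD f) x := by
  have hv := unchart_mem hx
  have h := extDerivWithin_comp_affine (f := fun v => f (chart s v)) hL.dirMap
    (unchart s (L (barycenter t))) (hf.differentiableOn _ (hL.mapsTo_chartDomain hv))
    (uniqueDiffOn_chartDomain t) (subset_closure_interior_chartDomain t hv) hv
    hL.mapsTo_chartDomain
  rw [← hL.unchart_map_chart, chart_unchart hx] at h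
  rw [pullback, extD, extD, ← h]
  exact extDerivWithin_congr' (fun v hv => by simp only [pullback, hL.chart_dirMap_add hv]) hv

theorem extD_faceRes (h : t ⊆ s) (hf : IsSmooth f) (hx : x ∈ closedSimplex t) :
    extD (faceRes h f) x = faceRes h (extD f) x :=
  extD_pullback hf _ hx

end LocalForm

end LocalForms

section ConeOperator

namespace LocalForm

variable {V : Type*} [Fintype V] [DecidableEq V] {s t : Finset V} {m : ℕ}
  {p x : EuclideanSpace ℝ V}

/-- The cone operator on forms on a simplex, with apex `p`. -/
def coneOp (p : EuclideanSpace ℝ V) (f : LocalForm s (m + 1)) : LocalForm s m := fun x =>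
  coneForm (unchart s p) (fun v => f (chart s v)) (unchart s x)

theorem IsSmooth.continuousOn_fderivWithin {f : LocalForm s m} (hf : IsSmooth f) :
    ContinuousOn (fderivWithin ℝ (fun v => f (chart s v)) (chartDomain s)) (chartDomain s) :=
  ((contDiffOn_infty_iff_fderivWithin (uniqueDiffOn_chartDomain s)).1 hf).2.continuousOn

variable {f : LocalForm s (m + 1)}

theorem IsSmooth.coneOp (hf : IsSmooth f) (hp : p ∈ closedSimplex s) : IsSmooth (coneOp p f) := by
  refine (contDiffOn_coneForm (convex_chartDomain s) (isCompact_chartDomain s)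
    (uniqueDiffOn_chartDomain s) (unchart_mem hp) hf).congr fun v _ => ?_
  simp only [LocalForm.coneOp, unchart_chart]

theorem extD_coneOp_add (hp : p ∈ closedSimplex s) (hf : IsSmooth f) (hx : x ∈ closedSimplex s) :
    extD (coneOp p f) x + coneOp p (extD f) x = f x := by
  have h := extDerivWithin_coneForm_add (convex_chartDomain s) (isCompact_chartDomain s)
    (uniqueDiffOn_chartDomain s) (unchart_mem hp) (unchart_mem hx) hf.differentiableOn
    hf.continuousOn_fderivWithin
  simpa only [extD, coneOp, unchart_chart, chart_unchart hx] using h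

theorem coneOp_extD_zero {f : LocalForm s 0} (hp : p ∈ closedSimplex s) (hf : IsSmooth f)
    (hx : x ∈ closedSimplex s) : coneOp p (extD f) x = f x - f p := by
  have h := coneForm_extDerivWithin_zero (convex_chartDomain s) (unchart_mem hp) (unchart_mem hx)
    hf.differentiableOn hf.continuousOn_fderivWithin
  simpa only [extD, coneOp, unchart_chart, chart_unchart hx, chart_unchart hp] using h

theorem coneOp_congr (hp : p ∈ closedSimplex s) {g : LocalForm s (m + 1)}
    (h : EqOn f g (closedSimplex s)) (hx : x ∈ closedSimplex s) :
    coneOp p f x = coneOp p g x := by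
  rw [coneOp, coneForm, coneAverage_congr (g := fun v => g (chart s v)) (convex_chartDomain s)
    (unchart_mem hp) (unchart_mem hx) fun v hv => h hv]
  rfl

theorem coneOp_eq_zero (hp : p ∈ closedSimplex s) (h : EqOn f 0 (closedSimplex s))
    (hx : x ∈ closedSimplex s) : coneOp p f x = 0 := by
  rw [coneOp_congr hp h hx]
  simp [coneOp, coneForm, coneAverage]

theorem unchart_sub_unchart (x p : EuclideanSpace ℝ V) :
    unchart s x - unchart s p = tangentProj s (x - p) := by
  simp [unchart]

theorem BoundedBy.coneOp {M : ℝ} (hf : BoundedBy f M) (hp : p ∈ closedSimplex s) :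
    BoundedBy (coneOp p f) (2 * M) := fun x hx => by
  have hcone := norm_coneForm_le (convex_chartDomain s) (unchart_mem hp) (unchart_mem hx)
    fun v hv => hf _ hv
  have hdist : ‖unchart s x - unchart s p‖ ≤ 2 := by
    rw [unchart_sub_unchart, Submodule.coe_norm, coe_tangentProj (sub_mem_simplexDir hx hp)]
    have hsub := norm_sub_le x p
    linarith [norm_le_one_of_mem_closedSimplex hx, norm_le_one_of_mem_closedSimplex hp]
  exact (hcone.trans (mul_le_mul_of_nonneg_left hdist (hf.nonneg hp))).trans_eq (mul_comm M 2)

theorem coneOp_apply (hp : p ∈ closedSimplex s) (hf : IsSmooth f) (hx : x ∈ closedSimplex s)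
    (w : Fin m → simplexDir s) :
    coneOp p f x w = ∫ r in (0 : ℝ)..1, r ^ m *
      f (AffineMap.lineMap p x r) (Matrix.vecCons (tangentProj s (x - p)) w) := by
  rw [coneOp, coneForm, ContinuousAlternatingMap.curryLeft_apply_apply, unchart_sub_unchart]
  refine (map_coneAverage (convex_chartDomain s) (unchart_mem hp) (unchart_mem hx)
    (ContDiffOn.continuousOn hf) m (ContinuousAlternatingMap.apply ℝ (simplexDir s) ℝ
      (Matrix.vecCons (tangentProj s (x - p)) w))).trans ?_
  simp only [coneAverage, chart_lineMap, chart_unchart hp, chart_unchart hx]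
  rfl

theorem faceRes_coneOp (h : t ⊆ s) (hp : p ∈ closedSimplex t) (hf : IsSmooth f)
    (hx : x ∈ closedSimplex t) : faceRes h (coneOp p f) x = coneOp p (faceRes h f) x := by
  ext w
  rw [coneOp_apply hp (hf.faceRes h) hx]
  change coneOp p f x ((isSimplexMap_id h).dirMap ∘ w) = _
  rw [coneOp_apply (closedSimplex_mono h hp) hf (closedSimplex_mono h hx)]
  have hdir : tangentProj s (x - p) = (isSimplexMap_id h).dirMap (tangentProj t (x - p)) := by
    ext1
    rw [IsSimplexMap.coe_dirMap, coe_tangentProj (sub_mem_simplexDir hx hp),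
      coe_tangentProj (simplexDir_mono h (sub_mem_simplexDir hx hp))]
    rfl
  have hvec : Matrix.vecCons (tangentProj s (x - p)) ((isSimplexMap_id h).dirMap ∘ w) =
      (isSimplexMap_id h).dirMap ∘ Matrix.vecCons (tangentProj t (x - p)) w := by
    rw [hdir]
    ext1 j
    refine Fin.cases ?_ (fun j => ?_) j <;> simp
  rw [hvec]
  rfl

end LocalForm

end ConeOperator

/-! ### Extension of forms from a face -/

section Collapse

theorem norm_proj_le {V : Type*} [Fintype V] (i : V) :
    ‖(EuclideanSpace.proj i : EuclideanSpace ℝ V →L[ℝ] ℝ)‖ ≤ 1 :=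
  ContinuousLinearMap.opNorm_le_bound _ zero_le_one fun x => by
    simpa using PiLp.norm_apply_le x i

variable {V : Type*} [DecidableEq V]

/-- The linear map that takes the vertex `i` to the vertex `j` and fixes the other vertices. -/
def collapse [Fintype V] (i j : V) : EuclideanSpace ℝ V →L[ℝ] EuclideanSpace ℝ V :=
  ContinuousLinearMap.id ℝ _ + (EuclideanSpace.proj i).smulRight
    (EuclideanSpace.single j (1 : ℝ) - EuclideanSpace.single i 1)

variable [Fintype V] {s t : Finset V} {i j : V} {x : EuclideanSpace ℝ V}

theorem collapse_apply_apply (i j l : V) (x : EuclideanSpace ℝ V) :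
    collapse i j x l = x l + x i * ((if l = j then 1 else 0) - if l = i then 1 else 0) := by
  simp [collapse]

theorem collapse_eq_self (hx : x i = 0) : collapse i j x = x := by
  simp [collapse, hx]

theorem collapse_apply_of_notMem (hx : ∀ l ∉ t, x l = 0) (hj : j ∈ s) (ht : t.erase i ⊆ s)
    {l : V} (hl : l ∉ s) : collapse i j x l = 0 := by
  have hlj : l ≠ j := fun h => hl (h ▸ hj)
  rw [collapse_apply_apply, if_neg hlj]
  split_ifs with hli
  · simp [hli]
  · simp [hx l fun hlt => hl (ht (Finset.mem_erase.2 ⟨hli, hlt⟩))]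

theorem sum_collapse (i j : V) (x : EuclideanSpace ℝ V) : ∑ l, collapse i j x l = ∑ l, x l := by
  simp [collapse_apply_apply, Finset.sum_add_distrib, ← Finset.mul_sum]

theorem isSimplexMap_collapse (hj : j ∈ s) (ht : t.erase i ⊆ s) :
    IsSimplexMap (collapse i j) t s where
  mapsTo x hx := by
    refine ⟨fun l => ?_, fun l => collapse_apply_of_notMem hx.2.1 hj ht,
      (sum_collapse i j x).trans hx.2.2⟩
    have hl := hx.1 l
    have hi := hx.1 i
    rw [collapse_apply_apply]
    split_ifs with hlj hli hli
    · simpa using hl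
    · simpa using add_nonneg hl hi
    · simp [hli]
    · simpa using hl
  map_dir v hv := ⟨fun l => collapse_apply_of_notMem hv.1 hj ht, (sum_collapse i j v).trans hv.2⟩

theorem norm_collapse_le (i j : V) : ‖collapse i j‖ ≤ 3 := by
  have hvec := norm_sub_le (EuclideanSpace.single j (1 : ℝ)) (EuclideanSpace.single i 1)
  have hshift : ‖(EuclideanSpace.proj i : EuclideanSpace ℝ V →L[ℝ] ℝ)‖ *
      ‖EuclideanSpace.single j (1 : ℝ) - EuclideanSpace.single i 1‖ ≤ 1 * 2 :=
    mul_le_mul (norm_proj_le i) (by simpa [one_add_one_eq_two] using hvec) (norm_nonneg _)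
      zero_le_one
  refine (norm_add_le _ _).trans ?_
  rw [ContinuousLinearMap.norm_smulRight_apply]
  linarith [ContinuousLinearMap.norm_id_le (𝕜 := ℝ) (E := EuclideanSpace ℝ V)]

end Collapse

section Extension

namespace LocalForm

variable {V : Type*} [Fintype V] {s t : Finset V} {k : ℕ} {i : V} {x : EuclideanSpace ℝ V}

/-- The product of a form with a barycentric coordinate. -/
def coordSMul (j : V) (f : LocalForm s k) : LocalForm s k := fun x => x j • f x

theorem norm_coordSMul_le (j : V) (f : LocalForm s k) (hx : x ∈ closedSimplex s) :
    ‖coordSMul j f x‖ ≤ ‖f x‖ :=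
  (norm_smul (x j) (f x)).le.trans
    (mul_le_of_le_one_left (norm_nonneg (f x)) (abs_le_one_of_mem_closedSimplex hx j))

variable [DecidableEq V]

theorem IsSmooth.coordSMul {f : LocalForm s k} (hf : IsSmooth f) (j : V) :
    IsSmooth (coordSMul j f) := by
  have hcoord : ContDiffOn ℝ ∞ (fun v : simplexDir s => chart s v j) (chartDomain s) :=
    (contDiff_const.add ((EuclideanSpace.proj j).comp (simplexDir s).subtypeL).contDiff).contDiffOn
  exact hcoord.smul hf

theorem IsSmooth.sum {ι : Type*} {f : ι → LocalForm s k} (u : Finset ι)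
    (hf : ∀ a ∈ u, IsSmooth (f a)) : IsSmooth (∑ a ∈ u, f a) :=
  Finset.sum_induction f IsSmooth (fun _ _ => IsSmooth.add) .zero hf

theorem extD_sum {ι : Type*} {f : ι → LocalForm s k} (u : Finset ι)
    (hf : ∀ a ∈ u, IsSmooth (f a)) (hx : x ∈ closedSimplex s) :
    extD (∑ a ∈ u, f a) x = ∑ a ∈ u, extD (f a) x := by
  classical
  induction u using Finset.induction_on with
  | empty => exact extD_eq_zero (fun _ _ => rfl) hx
  | insert a u ha ih =>
    rw [Finset.forall_mem_insert] at hf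
    rw [Finset.sum_insert ha, Finset.sum_insert ha, extD_add hf.1 (.sum u hf.2) hx, ih hf.2]

theorem norm_extD_coordSMul_le {f : LocalForm s k} (hf : IsSmooth f) (j : V)
    (hx : x ∈ closedSimplex s) :
    ‖extD (coordSMul j f) x‖ ≤ ‖extD f x‖ + (k + 1) * ‖f x‖ := by
  have hv := unchart_mem hx
  have hu := uniqueDiffOn_chartDomain s _ hv
  have hcoord : HasFDerivWithinAt (fun v => chart s v j)
      ((EuclideanSpace.proj j).comp (simplexDir s).subtypeL) (chartDomain s) (unchart s x) :=
    (((EuclideanSpace.proj j).comp (simplexDir s).subtypeL).hasFDerivAt.const_add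
      (barycenter s j)).hasFDerivWithinAt
  have hnorm : ‖fderivWithin ℝ (fun v => chart s v j) (chartDomain s) (unchart s x)‖ ≤ 1 := by
    rw [hcoord.fderivWithin hu]
    exact ContinuousLinearMap.opNorm_le_bound _ zero_le_one fun v => by
      simpa using PiLp.norm_apply_le (v : EuclideanSpace ℝ V) j
  refine (norm_extDerivWithin_smul_le hu hcoord.differentiableWithinAt
    (hf.differentiableOn _ hv)).trans ?_
  simp only [chart_unchart hx]
  gcongr
  · exact mul_le_of_le_one_left (norm_nonneg (extD f x)) (abs_le_one_of_mem_closedSimplex hx j)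
  · exact mul_le_of_le_one_left (norm_nonneg (f x)) hnorm

/-- The extension of a form from the face opposite to `i`, whose barycentric coordinates weight
the pullbacks under the collapses of `i` to the vertices of that face. Since a collapse maps each
face of the simplex to a face, the extension of a form that vanishes on the boundary of the face
opposite to `i` vanishes on all other faces. -/
def faceExt (i : V) (f : LocalForm (s.erase i) k) : LocalForm s k :=
  ∑ j : s.erase i, coordSMul (j : V) (pullback (isSimplexMap_collapse j.2 subset_rfl) f)

variable {f : LocalForm (s.erase i) k}

theorem faceExt_apply (f : LocalForm (s.erase i) k) (x : EuclideanSpace ℝ V) :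
    faceExt (s := s) i f x = ∑ j : s.erase i,
      coordSMul (j : V) (pullback (isSimplexMap_collapse j.2 subset_rfl) f) x :=
  Finset.sum_apply _ _ _

theorem IsSmooth.faceExt (hf : IsSmooth f) : IsSmooth (faceExt (s := s) i f) :=
  .sum _ fun j _ => (hf.pullback _).coordSMul j

theorem BoundedBy.faceExt {M : ℝ} (hM : BoundedBy f M) :
    BoundedBy (faceExt (s := s) i f) ((s.erase i).card * (3 ^ k * M)) := fun x hx => by
  rw [faceExt_apply, ← Fintype.card_coe, ← nsmul_eq_mul]
  refine (norm_sum_le (E := simplexDir s [⋀^Fin k]→L[ℝ] ℝ) _ _).trans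
    (Finset.sum_le_card_nsmul _ _ _ fun j _ => ?_)
  refine (norm_coordSMul_le _ _ hx).trans ((norm_pullback_le _ f x).trans ?_)
  gcongr
  exacts [norm_collapse_le i j, hM _ ((isSimplexMap_collapse j.2 subset_rfl).mapsTo hx)]

theorem BoundedBy.extD_faceExt (hf : IsSmooth f) {M M' : ℝ} (hM : BoundedBy f M)
    (hM' : BoundedBy (extD f) M') : BoundedBy (extD (LocalForm.faceExt (s := s) i f))
      ((s.erase i).card * (3 ^ (k + 1) * M' + (k + 1) * (3 ^ k * M))) := fun x hx => by
  have hsmooth : ∀ j : s.erase i,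
      IsSmooth (pullback (isSimplexMap_collapse (t := s) j.2 subset_rfl) f) :=
    fun j => hf.pullback _
  rw [LocalForm.faceExt, extD_sum _ (fun j _ => (hsmooth j).coordSMul j) hx, ← Fintype.card_coe,
    ← nsmul_eq_mul]
  refine (norm_sum_le (E := simplexDir s [⋀^Fin (k + 1)]→L[ℝ] ℝ) _ _).trans
    (Finset.sum_le_card_nsmul _ _ _ fun j _ => ?_)
  have hmem := (isSimplexMap_collapse (i := i) (t := s) j.2 subset_rfl).mapsTo hx
  refine (norm_extD_coordSMul_le (hsmooth j) j hx).trans ?_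
  rw [extD_pullback hf _ hx]
  gcongr
  · refine (norm_pullback_le _ (extD f) x).trans ?_
    gcongr
    exacts [norm_collapse_le i j, hM' _ hmem]
  · refine (norm_pullback_le _ f x).trans ?_
    gcongr
    exacts [norm_collapse_le i j, hM _ hmem]

theorem faceRes_faceExt_erase (f : LocalForm (s.erase i) k) :
    EqOn (faceRes (s.erase_subset i) (faceExt (s := s) i f)) f (closedSimplex (s.erase i)) := by
  intro x hx
  have hcollapse : ∀ y : EuclideanSpace ℝ V, (∀ l ∉ s.erase i, y l = 0) → ∀ j, collapse i j y = y :=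
    fun y hy j => collapse_eq_self (hy i (s.notMem_erase i))
  have hdir (j : s.erase i) (w : Fin k → simplexDir (s.erase i)) :
      (isSimplexMap_collapse j.2 subset_rfl).dirMap ∘
        ((isSimplexMap_id (s.erase_subset i)).dirMap ∘ w) = w := by
    ext1 l
    exact Subtype.ext (hcollapse _ (w l).2.1 j)
  have hsum : ∑ j : s.erase i, x j = 1 := by
    rw [Finset.sum_coe_sort, ← hx.2.2]
    exact Finset.sum_subset (Finset.subset_univ _) fun l _ hl => hx.2.1 l hl
  ext w
  rw [faceRes, pullback, ContinuousLinearMap.id_apply, faceExt_apply]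
  simp only [coordSMul, pullback, hcollapse x hx.2.1,
    ContinuousAlternatingMap.compContinuousLinearMap_apply, ContinuousAlternatingMap.sum_apply,
    ContinuousAlternatingMap.smul_apply, hdir, ← Finset.sum_smul, hsum, one_smul]

theorem faceRes_faceExt_eq_zero (h : t ⊆ s)
    (hf : EqOn (faceRes (Finset.erase_subset_erase i h) f) 0 (closedSimplex (t.erase i))) :
    EqOn (faceRes h (faceExt (s := s) i f)) 0 (closedSimplex t) := by
  intro x hx
  ext w
  rw [faceRes, pullback, ContinuousLinearMap.id_apply, faceExt_apply]
  rw [ContinuousAlternatingMap.compContinuousLinearMap_apply, ContinuousAlternatingMap.sum_apply]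
  refine Finset.sum_eq_zero fun j _ => ?_
  by_cases hj : (j : V) ∈ t
  · have hjt : (j : V) ∈ t.erase i := Finset.mem_erase.2 ⟨Finset.ne_of_mem_erase j.2, hj⟩
    have hL : IsSimplexMap (collapse i (j : V)) t (t.erase i) :=
      isSimplexMap_collapse hjt subset_rfl
    have hzero := congrArg (· w) (pullback_apply_eq_zero hL (hf (hL.mapsTo hx)))
    exact (congrArg (x j • ·) hzero).trans (smul_zero _)
  · simp [coordSMul, hx.2.1 j hj]

end LocalForm

end Extension

/-! ### Stokes' theorem on a simplex -/

section CoordSimplex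

open MeasureTheory
open scoped Pointwise

variable {k : ℕ} {r : ℝ}

/-- The coordinate simplex in `ℝᵏ`. -/
def coordSimplex (k : ℕ) : Set (Fin k → ℝ) := {y | (∀ j, 0 ≤ y j) ∧ ∑ j, y j ≤ 1}

theorem isCompact_coordSimplex (k : ℕ) : IsCompact (coordSimplex k) := by
  refine (isCompact_univ_pi fun _ : Fin k => isCompact_Icc (a := (0 : ℝ))
    (b := 1)).of_isClosed_subset ?_ fun y hy j _ => ⟨hy.1 j, ?_⟩
  · have hinter : coordSimplex k = (⋂ j, {y : Fin k → ℝ | 0 ≤ y j}) ∩ {y | ∑ j, y j ≤ 1} := by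
      ext y; simp [coordSimplex]
    rw [hinter]
    exact (isClosed_iInter fun j => isClosed_le continuous_const (by fun_prop)).inter
      (isClosed_le (by fun_prop) continuous_const)
  · exact (Finset.single_le_sum (fun l _ => hy.1 l) (Finset.mem_univ j)).trans hy.2

theorem measurableSet_coordSimplex (k : ℕ) : MeasurableSet (coordSimplex k) :=
  (isCompact_coordSimplex k).isClosed.measurableSet

theorem insertNth_last_mem_coordSimplex {a : ℝ} {y : Fin k → ℝ} :
    (Fin.last k).insertNth a y ∈ coordSimplex (k + 1) ↔
      0 ≤ a ∧ (∀ j, 0 ≤ y j) ∧ a + ∑ j, y j ≤ 1 := by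
  simp [coordSimplex, Fin.forall_iff_succAbove (Fin.last k),
    Fin.sum_univ_succAbove _ (Fin.last k), and_assoc]

/-- The cone parametrization of the coordinate simplex, with apex the last unit vector. -/
def conePt (r : ℝ) (z : Fin k → ℝ) : Fin (k + 1) → ℝ :=
  (Fin.last k).insertNth (1 - r) (r • z)

theorem conePt_last (r : ℝ) (z : Fin k → ℝ) : conePt r z (Fin.last k) = 1 - r := by
  simp [conePt]

theorem conePt_castSucc (r : ℝ) (z : Fin k → ℝ) (j : Fin k) :
    conePt r z j.castSucc = r * z j := by
  rw [← Fin.succAbove_last, conePt, Fin.insertNth_apply_succAbove, Pi.smul_apply, smul_eq_mul]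

theorem conePt_mem (hr : r ∈ Icc (0 : ℝ) 1) {z : Fin k → ℝ} (hz : z ∈ coordSimplex k) :
    conePt r z ∈ coordSimplex (k + 1) := by
  rw [conePt, insertNth_last_mem_coordSimplex]
  simp only [Pi.smul_apply, smul_eq_mul, ← Finset.mul_sum]
  exact ⟨sub_nonneg.2 hr.2, fun j => mul_nonneg hr.1 (hz.1 j),
    by linarith [mul_le_of_le_one_right hr.1 hz.2]⟩

theorem continuous_conePt : Continuous fun q : ℝ × (Fin k → ℝ) => conePt q.1 q.2 := by
  unfold conePt
  fun_prop

theorem slice_coordSimplex (hr : 0 < r) (hr1 : r ≤ 1) :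
    {y : Fin k → ℝ | (Fin.last k).insertNth (1 - r) y ∈ coordSimplex (k + 1)} =
      r • coordSimplex k := by
  ext y
  have hmul : ∀ j, 0 ≤ r⁻¹ * y j ↔ 0 ≤ y j := fun j => mul_nonneg_iff_of_pos_left (inv_pos.2 hr)
  have hsum : ∑ j, r⁻¹ * y j ≤ 1 ↔ 1 - r + ∑ j, y j ≤ 1 := by
    rw [← Finset.mul_sum, inv_mul_le_iff₀ hr]
    constructor <;> intro h <;> linarith
  rw [mem_smul_set_iff_inv_smul_mem₀ hr.ne', mem_ofPred_eq, insertNth_last_mem_coordSimplex]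
  simp only [coordSimplex, mem_ofPred_eq, Pi.smul_apply, smul_eq_mul, hmul, hsum, sub_nonneg, hr1,
    true_and]

theorem slice_coordSimplex_of_notMem {a : ℝ} (ha : a ∉ Icc (0 : ℝ) 1) :
    {y : Fin k → ℝ | (Fin.last k).insertNth a y ∈ coordSimplex (k + 1)} = ∅ := by
  refine eq_empty_of_forall_notMem fun y hy => ha ?_
  obtain ⟨ha0, hy0, hsum⟩ := insertNth_last_mem_coordSimplex.1 hy
  exact ⟨ha0, by linarith [Finset.sum_nonneg fun j (_ : j ∈ Finset.univ) => hy0 j]⟩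

variable {G : Type*} [NormedAddCommGroup G] [NormedSpace ℝ G]

theorem setIntegral_eq_integral_slices (i : Fin (k + 1)) {S : Set (Fin (k + 1) → ℝ)}
    (hS : MeasurableSet S) {g : (Fin (k + 1) → ℝ) → G} (hg : IntegrableOn g S) :
    ∫ y in S, g y = ∫ a : ℝ, ∫ y in {y | i.insertNth a y ∈ S}, g (i.insertNth a y) := by
  set e := (MeasurableEquiv.piFinSuccAbove (fun _ : Fin (k + 1) => ℝ) i).symm
  have he : MeasurePreserving e :=
    (volume_preserving_piFinSuccAbove (fun _ : Fin (k + 1) => ℝ) i).symm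
  have hS' : MeasurableSet (e ⁻¹' S) := e.measurable hS
  have hint : Integrable ((e ⁻¹' S).indicator (g ∘ e)) (volume.prod volume) :=
    (integrable_indicator_iff hS').2 ((he.integrableOn_comp_preimage e.measurableEmbedding).2 hg)
  rw [← he.setIntegral_preimage_emb e.measurableEmbedding, ← integral_indicator hS']
  refine (integral_prod _ hint).trans (integral_congr_ae (.of_forall fun a => ?_))
  exact integral_indicator (measurable_prodMk_left hS')

theorem integral_slice_coordSimplex (hr : r ∈ Ioc (0 : ℝ) 1) (g : (Fin (k + 1) → ℝ) → G) :
    ∫ y in {y : Fin k → ℝ | (Fin.last k).insertNth (1 - r) y ∈ coordSimplex (k + 1)},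
        g ((Fin.last k).insertNth (1 - r) y) =
      ∫ z in coordSimplex k, r ^ k • g (conePt r z) := by
  rw [slice_coordSimplex hr.1 hr.2, integral_smul]
  have hscale := Measure.setIntegral_comp_smul_of_pos (volume : Measure (Fin k → ℝ))
    (fun y => g ((Fin.last k).insertNth (1 - r) y)) (coordSimplex k) hr.1
  rw [Module.finrank_fin_fun] at hscale
  exact ((congrArg (r ^ k • ·) hscale).trans (smul_inv_smul₀ (pow_ne_zero k hr.1.ne') _)).symm

theorem integrable_cone_integrand {g : (Fin (k + 1) → ℝ) → G}
    (hg : ContinuousOn g (coordSimplex (k + 1))) :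
    Integrable (fun q : ℝ × (Fin k → ℝ) => q.1 ^ k • g (conePt q.1 q.2))
      ((volume.restrict (Ioc (0 : ℝ) 1)).prod (volume.restrict (coordSimplex k))) := by
  have hcont : ContinuousOn (fun q : ℝ × (Fin k → ℝ) => q.1 ^ k • g (conePt q.1 q.2))
      (Icc (0 : ℝ) 1 ×ˢ coordSimplex k) :=
    (continuous_fst.pow k).continuousOn.smul
      (hg.comp continuous_conePt.continuousOn fun q hq => conePt_mem hq.1 hq.2)
  rw [Measure.prod_restrict]
  exact IntegrableOn.mono_set
    (hcont.integrableOn_compact (isCompact_Icc.prod (isCompact_coordSimplex k)))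
    (prod_mono Ioc_subset_Icc_self subset_rfl)

theorem integral_coordSimplex_succ {g : (Fin (k + 1) → ℝ) → G}
    (hg : ContinuousOn g (coordSimplex (k + 1))) :
    ∫ y in coordSimplex (k + 1), g y =
      ∫ z in coordSimplex k, ∫ r in (0 : ℝ)..1, r ^ k • g (conePt r z) := by
  set slice : ℝ → G := fun a =>
    ∫ y in {y : Fin k → ℝ | (Fin.last k).insertNth a y ∈ coordSimplex (k + 1)},
      g ((Fin.last k).insertNth a y) with hslice
  have hzero : ∀ a ∉ Icc (0 : ℝ) 1, slice a = 0 := fun a ha => by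
    simp only [hslice, slice_coordSimplex_of_notMem ha, Measure.restrict_empty,
      integral_zero_measure]
  calc ∫ y in coordSimplex (k + 1), g y
    _ = ∫ a, slice a := setIntegral_eq_integral_slices _ (measurableSet_coordSimplex _)
        (hg.integrableOn_compact (isCompact_coordSimplex _))
    _ = ∫ a in (0 : ℝ)..1, slice a := by
        rw [intervalIntegral.integral_of_le zero_le_one, ← integral_Icc_eq_integral_Ioc,
          setIntegral_eq_integral_of_forall_compl_eq_zero hzero]
    _ = ∫ r in (0 : ℝ)..1, slice (1 - r) := by
        simp [intervalIntegral.integral_comp_sub_left]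
    _ = ∫ r in Ioc (0 : ℝ) 1, ∫ z in coordSimplex k, r ^ k • g (conePt r z) := by
        rw [intervalIntegral.integral_of_le zero_le_one]
        exact setIntegral_congr_fun measurableSet_Ioc fun r hr => integral_slice_coordSimplex hr g
    _ = _ := by
        simp only [intervalIntegral.integral_of_le zero_le_one]
        exact integral_integral_swap (integrable_cone_integrand hg)

end CoordSimplex

section Stokes

open MeasureTheory

variable {V : Type*} [LinearOrder V] {s t : Finset V} {k n : ℕ}

/-- The vertex that is last in the order of `V`; it serves as the apex of cones. -/
abbrev lastVertex (s : Finset V) (hs : s.card = n + 1) : V :=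
  s.orderEmbOfFin hs (Fin.last n)

theorem lastVertex_mem (hs : s.card = n + 1) : lastVertex s hs ∈ s := s.orderEmbOfFin_mem hs _

theorem card_erase_orderEmbOfFin (hs : s.card = n + 1) (i : Fin (n + 1)) :
    (s.erase (s.orderEmbOfFin hs i)).card = n := by
  rw [Finset.card_erase_of_mem (s.orderEmbOfFin_mem hs i), hs, Nat.add_sub_cancel]

theorem orderEmbOfFin_erase (hs : s.card = n + 1) (i : Fin (n + 1))
    (h : (s.erase (s.orderEmbOfFin hs i)).card = n) (j : Fin n) :
    (s.erase (s.orderEmbOfFin hs i)).orderEmbOfFin h j = s.orderEmbOfFin hs (i.succAbove j) := by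
  have hmono := (s.orderEmbOfFin hs).strictMono.comp (Fin.strictMono_succAbove i)
  have hmem : ∀ j, s.orderEmbOfFin hs (i.succAbove j) ∈ s.erase (s.orderEmbOfFin hs i) :=
    fun j => Finset.mem_erase.2 ⟨fun hj => Fin.succAbove_ne i j
      ((s.orderEmbOfFin hs).injective hj), s.orderEmbOfFin_mem hs _⟩
  exact (congrFun (Finset.orderEmbOfFin_unique h hmem hmono) j).symm

theorem lastVertex_erase (hs : s.card = n + 2) (j : Fin (n + 1))
    (h : (s.erase (s.orderEmbOfFin hs j.castSucc)).card = n + 1) :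
    lastVertex (s.erase (s.orderEmbOfFin hs j.castSucc)) h = lastVertex s hs := by
  rw [lastVertex, orderEmbOfFin_erase hs j.castSucc, Fin.succAbove_of_le_castSucc]
  · rfl
  · exact Fin.castSucc_le_castSucc_iff.2 (Fin.le_last j)

section Parametrization

variable [Fintype V]

/-- The edge vectors from the first vertex of `s` to the others. -/
def edges (s : Finset V) (hs : s.card = k + 1) (j : Fin k) : simplexDir s :=
  edgeVec s (s.orderEmbOfFin hs 0) (s.orderEmbOfFin hs j.succ)
    (s.orderEmbOfFin_mem hs 0) (s.orderEmbOfFin_mem hs j.succ)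

/-- The affine parametrization of the simplex spanned by `s` by the coordinate simplex. -/
def simplexPt (s : Finset V) (hs : s.card = k + 1) (y : Fin k → ℝ) : EuclideanSpace ℝ V :=
  EuclideanSpace.single (s.orderEmbOfFin hs 0) 1 + ∑ j, y j • (edges s hs j).val

theorem single_lastVertex_mem (hs : s.card = n + 1) :
    EuclideanSpace.single (lastVertex s hs) 1 ∈ closedSimplex s :=
  single_mem_closedSimplex (lastVertex_mem hs)

theorem coe_edges (hs : s.card = k + 1) (j : Fin k) : (edges s hs j : EuclideanSpace ℝ V) =
    EuclideanSpace.single (s.orderEmbOfFin hs j.succ) 1 -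
      EuclideanSpace.single (s.orderEmbOfFin hs 0) 1 := rfl

theorem simplexPt_eq_sum (hs : s.card = k + 1) (y : Fin k → ℝ) :
    simplexPt s hs y = ∑ j : Fin (k + 1), (Fin.cons (1 - ∑ j, y j) y : Fin (k + 1) → ℝ) j •
      EuclideanSpace.single (s.orderEmbOfFin hs j) (1 : ℝ) := by
  rw [Fin.sum_univ_succ]
  simp only [simplexPt, coe_edges, smul_sub, Finset.sum_sub_distrib, Fin.cons_zero,
    Fin.cons_succ, ← Finset.sum_smul, sub_smul, one_smul]
  abel

theorem simplexPt_mem (hs : s.card = k + 1) {y : Fin k → ℝ} (hy : y ∈ coordSimplex k) :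
    simplexPt s hs y ∈ closedSimplex s := by
  rw [simplexPt_eq_sum]
  refine (convex_closedSimplex s).sum_mem (fun j _ => ?_) ?_ fun j _ =>
    single_mem_closedSimplex (s.orderEmbOfFin_mem hs j)
  · cases j using Fin.cases with
    | zero => simpa using hy.2
    | succ j => simpa using hy.1 j
  · rw [Fin.sum_univ_succ]
    simp

theorem continuous_simplexPt (hs : s.card = k + 1) : Continuous (simplexPt s hs) := by
  unfold simplexPt
  fun_prop

end Parametrization

namespace LocalForm

variable [Fintype V]

/-- The integral of a form of top degree over a simplex, oriented by the order of the
vertices. -/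
def integral (hs : s.card = k + 1) (f : LocalForm s k) : ℝ :=
  ∫ y in coordSimplex k, f (simplexPt s hs y) (edges s hs)

section Integral

variable {f g : LocalForm s k}

theorem IsSmooth.continuousOn_simplexPt (hs : s.card = k + 1) (hf : f.IsSmooth)
    (w : Fin k → simplexDir s) :
    ContinuousOn (fun y => f (simplexPt s hs y) w) (coordSimplex k) :=
  (ContinuousAlternatingMap.apply ℝ (simplexDir s) ℝ w).continuous.comp_continuousOn
    (hf.continuousOn.comp (continuous_simplexPt hs).continuousOn fun _ => simplexPt_mem hs)

theorem IsSmooth.integrableOn_simplexPt (hs : s.card = k + 1) (hf : f.IsSmooth) :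
    IntegrableOn (fun y => f (simplexPt s hs y) (edges s hs)) (coordSimplex k) :=
  (hf.continuousOn_simplexPt hs _).integrableOn_compact (isCompact_coordSimplex k)

theorem integral_congr (hs : s.card = k + 1) (h : EqOn f g (closedSimplex s)) :
    f.integral hs = g.integral hs :=
  setIntegral_congr_fun (measurableSet_coordSimplex k) fun _ hy =>
    congrArg (· (edges s hs)) (h (simplexPt_mem hs hy))

theorem integral_eq_zero (hs : s.card = k + 1) (h : EqOn f 0 (closedSimplex s)) :
    f.integral hs = 0 := by
  rw [integral_congr hs h]
  simp [integral]

theorem integral_add (hs : s.card = k + 1) (hf : f.IsSmooth) (hg : g.IsSmooth) :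
    (f + g).integral hs = f.integral hs + g.integral hs :=
  MeasureTheory.integral_add (hf.integrableOn_simplexPt hs) (hg.integrableOn_simplexPt hs)

theorem integral_sub (hs : s.card = k + 1) (hf : f.IsSmooth) (hg : g.IsSmooth) :
    (f - g).integral hs = f.integral hs - g.integral hs :=
  MeasureTheory.integral_sub (hf.integrableOn_simplexPt hs) (hg.integrableOn_simplexPt hs)

theorem integral_const_smul (hs : s.card = k + 1) (c : ℝ) (f : LocalForm s k) :
    integral hs (c • f) = c * f.integral hs :=
  integral_const_mul c _

theorem integral_zero_form (hs : s.card = 1) (f : LocalForm s 0) (w : Fin 0 → simplexDir s) :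
    f.integral hs = f (EuclideanSpace.single (s.orderEmbOfFin hs 0) 1) w := by
  have huniv : coordSimplex 0 = univ := by ext y; simp [coordSimplex]
  rw [integral, huniv, Measure.restrict_univ, Measure.volume_pi_eq_dirac 0, integral_dirac,
    Subsingleton.elim (edges s hs) w]
  simp [simplexPt]

theorem integral_faceRes_congr {t t' : Finset V} (h : t = t') (ht : t ⊆ s) (ht' : t' ⊆ s)
    (hc : t.card = k + 1) (hc' : t'.card = k + 1) (f : LocalForm s k) :
    (faceRes ht f).integral hc = (faceRes ht' f).integral hc' := by
  subst h
  rfl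

end Integral

section ConeIntegral

variable (hs : s.card = k + 2) (hF : (s.erase (lastVertex s hs)).card = k + 1)

theorem dirMap_edges (j : Fin k) :
    (isSimplexMap_id (Finset.erase_subset _ s)).dirMap (edges (s.erase (lastVertex s hs)) hF j) =
      edges s hs j.castSucc := by
  ext1
  rw [IsSimplexMap.coe_dirMap, coe_edges, coe_edges, orderEmbOfFin_erase, orderEmbOfFin_erase]
  simp

theorem simplexPt_sub_apex (z : Fin k → ℝ) :
    simplexPt (s.erase (lastVertex s hs)) hF z - EuclideanSpace.single (lastVertex s hs) 1 =
      ((-edges s hs (Fin.last k) + ∑ j, z j • edges s hs (Fin.castSucc j) : simplexDir s) :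
        EuclideanSpace ℝ V) := by
  have hedges : ∀ j, (edges (s.erase (lastVertex s hs)) hF j).val =
      (edges s hs j.castSucc).val := fun j => congrArg Subtype.val (dirMap_edges hs hF j)
  simp only [simplexPt, orderEmbOfFin_erase, hedges, Submodule.coe_add, Submodule.coe_neg,
    Submodule.coe_sum, Submodule.coe_smul, coe_edges hs (Fin.last k), Fin.succAbove_last,
    Fin.castSucc_zero, Fin.succ_last]
  abel

theorem lineMap_apex_simplexPt (r : ℝ) (z : Fin k → ℝ) :
    AffineMap.lineMap (EuclideanSpace.single (lastVertex s hs) (1 : ℝ))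
      (simplexPt (s.erase (lastVertex s hs)) hF z) r = simplexPt s hs (conePt r z) := by
  rw [AffineMap.lineMap_apply, vsub_eq_sub, vadd_eq_add, simplexPt_sub_apex, simplexPt,
    Fin.sum_univ_castSucc]
  simp only [conePt_last, conePt_castSucc, mul_smul, ← Finset.smul_sum, Submodule.coe_add,
    Submodule.coe_neg, Submodule.coe_sum, Submodule.coe_smul, coe_edges hs (Fin.last k),
    Fin.succ_last, smul_add, smul_neg, smul_sub, sub_smul, one_smul]
  abel

theorem map_vecCons_apex (g : simplexDir s [⋀^Fin (k + 1)]→L[ℝ] ℝ) (z : Fin k → ℝ) :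
    g (Matrix.vecCons (-edges s hs (Fin.last k) + ∑ j, z j • edges s hs (Fin.castSucc j))
      fun j => edges s hs (Fin.castSucc j)) = (-1) ^ (k + 1) * g (edges s hs) := by
  have hrepeat : ∀ j, g (Matrix.vecCons (edges s hs (Fin.castSucc j))
      fun j => edges s hs (Fin.castSucc j)) = 0 := fun j =>
    g.map_eq_zero_of_eq (i := 0) (j := j.succ) _ (by simp) (Fin.succ_ne_zero j).symm
  have hinsert : (Fin.last k).insertNth (edges s hs (Fin.last k))
      (fun j => edges s hs (Fin.castSucc j)) = edges s hs := by
    rw [Fin.insertNth_eq_iff]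
    exact ⟨rfl, funext fun j => by simp [Fin.removeNth]⟩
  have hrotate := g.neg_one_pow_smul_map_insertNth (Fin.last k) (edges s hs (Fin.last k))
    fun j => edges s hs (Fin.castSucc j)
  rw [hinsert, Fin.val_last, zsmul_eq_mul, Int.cast_pow, Int.cast_neg, Int.cast_one] at hrotate
  simp only [← ContinuousAlternatingMap.curryLeft_apply_apply] at hrepeat ⊢
  simp only [map_add, map_neg, map_sum, map_smul, ContinuousAlternatingMap.add_apply,
    ContinuousAlternatingMap.neg_apply, ContinuousAlternatingMap.sum_apply,
    ContinuousAlternatingMap.smul_apply, hrepeat, smul_zero, Finset.sum_const_zero, add_zero]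
  rw [ContinuousAlternatingMap.curryLeft_apply_apply, ← hrotate]
  ring

theorem faceRes_coneOp_apex_apply {f : LocalForm s (k + 1)} (hf : f.IsSmooth) {z : Fin k → ℝ}
    (hz : z ∈ coordSimplex k) :
    faceRes (Finset.erase_subset _ s) (coneOp (EuclideanSpace.single (lastVertex s hs) 1) f)
      (simplexPt (s.erase (lastVertex s hs)) hF z) (edges (s.erase (lastVertex s hs)) hF) =
    ∫ r in (0 : ℝ)..1, r ^ k * ((-1) ^ (k + 1) *
      f (simplexPt s hs (conePt r z)) (edges s hs)) := by
  have hx := closedSimplex_mono (Finset.erase_subset (lastVertex s hs) s) (simplexPt_mem hF hz)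
  have hedges : (isSimplexMap_id (Finset.erase_subset (lastVertex s hs) s)).dirMap ∘
      edges (s.erase (lastVertex s hs)) hF = fun j => edges s hs (Fin.castSucc j) :=
    funext (dirMap_edges hs hF)
  change coneOp _ f _ ((isSimplexMap_id (Finset.erase_subset _ s)).dirMap ∘ edges _ hF) = _
  change coneOp _ f (simplexPt (s.erase (lastVertex s hs)) hF z) _ = _
  rw [hedges, coneOp_apply (single_lastVertex_mem hs) hf hx, simplexPt_sub_apex, tangentProj_coe]
  simp only [map_vecCons_apex, lineMap_apex_simplexPt]

theorem integral_eq_coneOp {f : LocalForm s (k + 1)} (hf : f.IsSmooth) :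
    f.integral hs = (-1) ^ (k + 1) * (faceRes (Finset.erase_subset _ s)
      (coneOp (EuclideanSpace.single (lastVertex s hs) 1) f)).integral hF := by
  rw [integral, integral_coordSimplex_succ (hf.continuousOn_simplexPt hs _), integral,
    ← integral_const_mul]
  refine setIntegral_congr_fun (measurableSet_coordSimplex k) fun z hz => ?_
  simp only [faceRes_coneOp_apex_apply hs hF hf hz, smul_eq_mul]
  rw [← intervalIntegral.integral_const_mul]
  refine intervalIntegral.integral_congr fun r _ => ?_
  have hsign : (-1 : ℝ) ^ (k + 1) * (-1) ^ (k + 1) = 1 := by rw [← mul_pow]; simp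
  linear_combination (-(r ^ k * f (simplexPt s hs (conePt r z)) (edges s hs))) * hsign

end ConeIntegral

theorem integral_extD_zero_form (hs : s.card = 2) {f : LocalForm s 0} (hf : f.IsSmooth)
    (w : Fin 0 → simplexDir s) :
    (extD f).integral hs = f (EuclideanSpace.single (s.orderEmbOfFin hs 1) 1) w -
      f (EuclideanSpace.single (s.orderEmbOfFin hs 0) 1) w := by
  rw [integral_eq_coneOp hs (card_erase_orderEmbOfFin hs _) hf.extD,
    integral_zero_form _ _ 0, orderEmbOfFin_erase]
  have hcone := coneOp_extD_zero (single_lastVertex_mem hs) hf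
    (single_mem_closedSimplex (s.orderEmbOfFin_mem hs 0))
  change (-1) ^ (0 + 1) * coneOp (EuclideanSpace.single (s.orderEmbOfFin hs 1) 1) (extD f)
    (EuclideanSpace.single (s.orderEmbOfFin hs 0) 1) _ = _
  refine (congrArg (fun g : simplexDir s [⋀^Fin 0]→L[ℝ] ℝ => (-1) ^ (0 + 1) * g _) hcone).trans ?_
  rw [ContinuousAlternatingMap.sub_apply, show (-1 : ℝ) ^ (0 + 1) = -1 from pow_one _, neg_one_mul,
    neg_sub]
  congr 2 <;> exact Subsingleton.elim _ _

theorem integral_faceRes_coneOp_extD (hs : s.card = k + 3)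
    (hF : (s.erase (lastVertex s hs)).card = k + 2) {f : LocalForm s (k + 1)} (hf : f.IsSmooth) :
    (faceRes (Finset.erase_subset _ s)
      (coneOp (EuclideanSpace.single (lastVertex s hs) 1) (extD f))).integral hF =
    (faceRes (Finset.erase_subset _ s) f).integral hF -
      (extD (faceRes (Finset.erase_subset _ s)
        (coneOp (EuclideanSpace.single (lastVertex s hs) 1) f))).integral hF := by
  have hq := single_lastVertex_mem hs
  rw [← integral_sub hF (hf.faceRes _) ((hf.coneOp hq).faceRes _).extD]
  refine integral_congr hF fun x hx => ?_
  have hhomotopy : EqOn (extD (coneOp _ f) + coneOp _ (extD f)) f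
      (closedSimplex (s.erase (lastVertex s hs))) := fun y hy =>
    extD_coneOp_add hq hf (closedSimplex_mono (Finset.erase_subset _ s) hy)
  rw [Pi.sub_apply, extD_faceRes _ (hf.coneOp hq) hx, eq_sub_iff_add_eq', ← Pi.add_apply]
  exact faceRes_congr (Finset.erase_subset _ s) hhomotopy hx

theorem integral_faceRes_eq_coneOp (hts : t ⊆ s) (ht : t.card = k + 2) {q : V}
    (hq : lastVertex t ht = q) (hF : (t.erase q).card = k + 1)
    {f : LocalForm s (k + 1)} (hf : f.IsSmooth) :
    (faceRes hts f).integral ht = (-1) ^ (k + 1) *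
      (faceRes ((Finset.erase_subset _ t).trans hts)
        (coneOp (EuclideanSpace.single q 1) f)).integral hF := by
  subst hq
  rw [integral_eq_coneOp ht hF (hf.faceRes hts)]
  congr 1
  have hres : EqOn (faceRes hts (coneOp (EuclideanSpace.single (lastVertex t ht) 1) f))
      (coneOp (EuclideanSpace.single (lastVertex t ht) 1) (faceRes hts f))
      (closedSimplex (t.erase (lastVertex t ht))) := fun x hx =>
    faceRes_coneOp hts (single_lastVertex_mem ht) hf (closedSimplex_mono (t.erase_subset _) hx)
  exact (integral_congr hF (faceRes_congr (t.erase_subset _) hres)).symm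

theorem integral_faceRes_faceRes_coneOp (hs : s.card = k + 3)
    (hF : (s.erase (lastVertex s hs)).card = k + 2) {f : LocalForm s (k + 1)} (hf : f.IsSmooth)
    (j : Fin (k + 2)) :
    (faceRes (Finset.erase_subset _ _) (faceRes (Finset.erase_subset _ s)
      (coneOp (EuclideanSpace.single (lastVertex s hs) 1) f))).integral
        (card_erase_orderEmbOfFin hF j) =
    (-1) ^ (k + 1) * (faceRes (Finset.erase_subset _ s) f).integral
      (card_erase_orderEmbOfFin hs j.castSucc) := by
  have hG := card_erase_orderEmbOfFin hs j.castSucc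
  have hlast := lastVertex_erase hs j hG
  have hset : (s.erase (lastVertex s hs)).erase
      ((s.erase (lastVertex s hs)).orderEmbOfFin hF j) =
      (s.erase (s.orderEmbOfFin hs j.castSucc)).erase (lastVertex s hs) := by
    rw [orderEmbOfFin_erase hs (Fin.last (k + 2)), Fin.succAbove_last, Finset.erase_right_comm]
  have hsign : (-1 : ℝ) ^ (k + 1) * (-1) ^ (k + 1) = 1 := by rw [← mul_pow]; simp
  have hGF := hset ▸ card_erase_orderEmbOfFin hF j
  rw [integral_faceRes_eq_coneOp (Finset.erase_subset _ s) hG hlast hGF hf, ← mul_assoc, hsign,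
    one_mul]
  exact integral_faceRes_congr hset ((Finset.erase_subset _ _).trans (Finset.erase_subset _ s)) _
    (card_erase_orderEmbOfFin hF j) hGF (coneOp _ f)

/-- The integral over the boundary of the simplex `s`, with the boundary orientation, of a family
of forms on its codimension one faces: the face opposite to the vertex `j` carries `b j`. -/
def boundaryIntegral (hs : s.card = k + 2) (b : ∀ j : V, LocalForm (s.erase j) k) : ℝ :=
  ∑ i : Fin (k + 2), (-1) ^ (i : ℕ) *
    (b (s.orderEmbOfFin hs i)).integral (card_erase_orderEmbOfFin hs i)

theorem boundaryIntegral_congr (hs : s.card = k + 2) {b c : ∀ j : V, LocalForm (s.erase j) k}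
    (h : ∀ j ∈ s, EqOn (b j) (c j) (closedSimplex (s.erase j))) :
    boundaryIntegral hs b = boundaryIntegral hs c :=
  Finset.sum_congr rfl fun i _ =>
    congrArg _ (integral_congr _ (h _ (s.orderEmbOfFin_mem hs i)))

theorem integral_extD (hs : s.card = k + 2) {f : LocalForm s k} (hf : f.IsSmooth) :
    (extD f).integral hs = boundaryIntegral hs fun j => faceRes (s.erase_subset j) f := by
  rw [boundaryIntegral]
  induction k generalizing s with
  | zero =>
    rw [integral_extD_zero_form hs hf 0, Fin.sum_univ_two]
    simp only [integral_zero_form _ _ 0, orderEmbOfFin_erase]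
    change _ = (-1) ^ 0 * f (EuclideanSpace.single (s.orderEmbOfFin hs 1) 1) 0 +
      (-1) ^ 1 * f (EuclideanSpace.single (s.orderEmbOfFin hs 0) 1) 0
    ring
  | succ k ih =>
    have hF := card_erase_orderEmbOfFin hs (Fin.last (k + 2))
    have hsign : (-1 : ℝ) ^ (k + 1) * (-1) ^ (k + 1) = 1 := by rw [← mul_pow]; simp
    rw [Fin.sum_univ_castSucc, integral_eq_coneOp hs hF hf.extD,
      integral_faceRes_coneOp_extD hs hF hf,
      ih hF ((hf.coneOp (single_lastVertex_mem hs)).faceRes _)]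
    simp only [integral_faceRes_faceRes_coneOp hs hF hf, mul_sub, Finset.mul_sum, Fin.val_castSucc,
      Fin.val_last]
    rw [sub_eq_neg_add, ← Finset.sum_neg_distrib]
    congr 1
    refine Finset.sum_congr rfl fun j _ => ?_
    linear_combination ((-1) ^ (j : ℕ) * (faceRes (Finset.erase_subset _ s) f).integral
      (card_erase_orderEmbOfFin hs j.castSucc)) * hsign

end LocalForm

end Stokes

/-! ### Bounded primitives on one simplex -/

section LocalPoincare

namespace LocalForm

section Relative

variable {V : Type*} [Fintype V] {s t : Finset V} {k : ℕ} {p x : EuclideanSpace ℝ V}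

theorem eq_zero_of_faceRes_zero_form (h : t ⊆ s) {f : LocalForm s 0} (hf : faceRes h f x = 0) :
    f x = 0 := by
  ext w
  rw [Subsingleton.elim w fun j => j.elim0]
  exact (congrArg (f x) (Subsingleton.elim _ _)).trans (DFunLike.congr_fun hf fun j => j.elim0)

variable [DecidableEq V]

/-- The restrictions of the form to all codimension one faces vanish. -/
def VanishesOnBoundary (f : LocalForm s k) : Prop :=
  ∀ j ∈ s, EqOn (faceRes (s.erase_subset j) f) 0 (closedSimplex (s.erase j))

/-- The form `g` is a primitive of `f` that vanishes on the boundary of the simplex. -/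
structure IsRelativePrimitive (g : LocalForm s k) (f : LocalForm s (k + 1)) : Prop where
  smooth : g.IsSmooth
  vanishesOnBoundary : g.VanishesOnBoundary
  extD_eqOn : EqOn (extD g) f (closedSimplex s)

theorem eq_zero_of_closed {f : LocalForm s 0} (hf : f.IsSmooth)
    (hd : EqOn (extD f) 0 (closedSimplex s)) (hp : p ∈ closedSimplex s) (hfp : f p = 0) :
    EqOn f 0 (closedSimplex s) := fun x hx => by
  have h := coneOp_extD_zero hp hf hx
  rw [coneOp_eq_zero hp hd hx, hfp, sub_zero] at h
  exact h.symm

theorem extD_coneOp_of_closed {f : LocalForm s (k + 1)} (hf : f.IsSmooth)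
    (hd : EqOn (extD f) 0 (closedSimplex s)) (hp : p ∈ closedSimplex s) :
    EqOn (extD (coneOp p f)) f (closedSimplex s) := fun x hx => by
  have h := extD_coneOp_add hp hf hx
  rwa [coneOp_eq_zero hp hd hx, add_zero] at h

theorem VanishesOnBoundary.faceRes_coneOp {f : LocalForm s (k + 1)} (hb : f.VanishesOnBoundary)
    (hf : f.IsSmooth) {q j : V} (hq : q ∈ s) (hj : j ∈ s) (hjq : j ≠ q) :
    EqOn (faceRes (s.erase_subset j) (coneOp (EuclideanSpace.single q 1) f)) 0
      (closedSimplex (s.erase j)) := fun x hx => by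
  have hp : EuclideanSpace.single q (1 : ℝ) ∈ closedSimplex (s.erase j) :=
    single_mem_closedSimplex (Finset.mem_erase.2 ⟨hjq.symm, hq⟩)
  rw [LocalForm.faceRes_coneOp _ hp hf hx]
  exact coneOp_eq_zero hp (hb j hj) hx

variable {q : V}

theorem VanishesOnBoundary.faceRes_faceExt {g : LocalForm (s.erase q) k}
    (hg : g.VanishesOnBoundary) {j : V} (hj : j ∈ s) (hjq : j ≠ q) :
    EqOn (faceRes (s.erase_subset j) (faceExt q g)) 0 (closedSimplex (s.erase j)) := by
  have hset : (s.erase j).erase q = (s.erase q).erase j := Finset.erase_right_comm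
  refine faceRes_faceExt_eq_zero _ fun z hz => ?_
  exact pullback_apply_eq_zero (isSimplexMap_id hset.subset)
    (hg j (Finset.mem_erase.2 ⟨hjq, hj⟩) (hset ▸ hz))

theorem VanishesOnBoundary.faceRes_extD_faceExt {g : LocalForm (s.erase q) k}
    (hg : g.VanishesOnBoundary) (hsmooth : g.IsSmooth) {j : V} (hj : j ∈ s) (hjq : j ≠ q) :
    EqOn (faceRes (s.erase_subset j) (extD (faceExt q g))) 0 (closedSimplex (s.erase j)) :=
  fun x hx => by
    rw [← extD_faceRes _ hsmooth.faceExt hx]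
    exact extD_eq_zero (hg.faceRes_faceExt hj hjq) hx

theorem faceRes_extD_faceExt_erase {g : LocalForm (s.erase q) k} (hg : g.IsSmooth) :
    EqOn (faceRes (s.erase_subset q) (extD (faceExt (s := s) q g))) (extD g)
      (closedSimplex (s.erase q)) := fun x hx => by
  rw [← extD_faceRes _ hg.faceExt hx]
  exact extD_congr (faceRes_faceExt_erase g) hx

theorem exists_boundedBy_faceExt (s : Finset V) (q : V) (k : ℕ) :
    ∃ C : ℝ, 0 ≤ C ∧ ∀ g : LocalForm (s.erase q) k, g.IsSmooth → ∀ M : ℝ, 0 ≤ M →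
      BoundedBy g M → BoundedBy (extD g) M →
      BoundedBy (faceExt (s := s) q g) (C * M) ∧
        BoundedBy (extD (faceExt (s := s) q g)) (C * M) := by
  refine ⟨(s.erase q).card * (3 ^ (k + 1) + (k + 1) * 3 ^ k), by positivity,
    fun g hg M hM hgM hdM => ⟨hgM.faceExt.mono ?_, (hgM.extD_faceExt hg hdM).mono ?_⟩⟩
  · have hpow : (0 : ℝ) ≤ 3 ^ (k + 1) + k * 3 ^ k := by positivity
    rw [mul_assoc]
    gcongr
    linarith
  · exact (by ring : _ = _).le

end Relative

variable {V : Type*} [Fintype V] [LinearOrder V] {s : Finset V} {k n : ℕ}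

/-- A form that satisfies the necessary conditions for being the exterior derivative of a form
vanishing on the boundary of the simplex. -/
structure IsRelativeCocycle (f : LocalForm s k) : Prop where
  smooth : f.IsSmooth
  closed : EqOn (extD f) 0 (closedSimplex s)
  vanishesOnBoundary : f.VanishesOnBoundary
  integral_eq_zero : ∀ hs : s.card = k + 1, f.integral hs = 0

namespace IsRelativeCocycle

theorem eq_zero {f : LocalForm s 0} (hf : f.IsRelativeCocycle) : EqOn f 0 (closedSimplex s) := by
  intro x hx
  obtain ⟨n, hs⟩ := Nat.exists_eq_add_one.2 (nonempty_of_mem_closedSimplex hx).card_pos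
  have hmem := s.orderEmbOfFin_mem hs 0
  refine eq_zero_of_closed hf.smooth hf.closed (single_mem_closedSimplex hmem) ?_ hx
  rcases Nat.eq_zero_or_pos n with rfl | hn
  · ext w
    rw [← integral_zero_form hs f w, hf.integral_eq_zero hs]
    rfl
  · obtain ⟨j, hj, hne⟩ := Finset.exists_mem_ne (s := s) (by lia) (s.orderEmbOfFin hs 0)
    exact eq_zero_of_faceRes_zero_form (s.erase_subset j)
      (hf.vanishesOnBoundary j hj (single_mem_closedSimplex (Finset.mem_erase.2 ⟨hne.symm, hmem⟩)))

variable {f : LocalForm s (k + 1)}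

theorem faceRes_coneOp (hf : f.IsRelativeCocycle) (hs : s.card = n + 1) :
    (faceRes (s.erase_subset (lastVertex s hs))
      (coneOp (EuclideanSpace.single (lastVertex s hs) 1) f)).IsRelativeCocycle where
  smooth := (hf.smooth.coneOp (single_lastVertex_mem hs)).faceRes _
  closed x hx := by
    rw [extD_faceRes _ (hf.smooth.coneOp (single_lastVertex_mem hs)) hx]
    have hd := (extD_coneOp_of_closed hf.smooth hf.closed (single_lastVertex_mem hs)).mono
      (closedSimplex_mono (s.erase_subset (lastVertex s hs)))
    exact (faceRes_congr _ hd hx).trans (hf.vanishesOnBoundary _ (lastVertex_mem hs) hx)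
  vanishesOnBoundary j hj x hx := by
    obtain ⟨hjq, hjs⟩ := Finset.mem_erase.1 hj
    have hsub := Finset.erase_subset_erase j (s.erase_subset (lastVertex s hs))
    exact pullback_apply_eq_zero (isSimplexMap_id hsub) (hf.vanishesOnBoundary.faceRes_coneOp
      hf.smooth (lastVertex_mem hs) hjs hjq (closedSimplex_mono hsub hx))
  integral_eq_zero hF := by
    obtain rfl : n = k + 1 := by rw [← hF, card_erase_orderEmbOfFin]
    have hint := integral_eq_coneOp hs hF hf.smooth
    rw [hf.integral_eq_zero hs] at hint
    exact (mul_eq_zero.1 hint.symm).resolve_left (by positivity)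

theorem isRelativePrimitive_coneOp_sub (hf : f.IsRelativeCocycle) (hs : s.card = n + 1)
    {e : LocalForm s k} (he : e.IsSmooth) (hclosed : EqOn (extD e) 0 (closedSimplex s))
    (hlast : EqOn (faceRes (s.erase_subset (lastVertex s hs)) e)
      (faceRes (s.erase_subset (lastVertex s hs))
        (coneOp (EuclideanSpace.single (lastVertex s hs) 1) f))
      (closedSimplex (s.erase (lastVertex s hs))))
    (hother : ∀ j ∈ s, j ≠ lastVertex s hs →
      EqOn (faceRes (s.erase_subset j) e) 0 (closedSimplex (s.erase j))) :
    IsRelativePrimitive (coneOp (EuclideanSpace.single (lastVertex s hs) 1) f - e) f where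
  smooth := (hf.smooth.coneOp (single_lastVertex_mem hs)).sub he
  vanishesOnBoundary j hj x hx := by
    rw [faceRes_sub, Pi.sub_apply]
    by_cases hjq : j = lastVertex s hs
    · subst hjq
      exact sub_eq_zero.2 (hlast hx).symm
    · exact sub_eq_zero.2 ((hf.vanishesOnBoundary.faceRes_coneOp hf.smooth (lastVertex_mem hs)
        hj hjq hx).trans (hother j hj hjq hx).symm)
  extD_eqOn x hx := by
    rw [extD_sub (hf.smooth.coneOp (single_lastVertex_mem hs)) he hx, hclosed hx,
      extD_coneOp_of_closed hf.smooth hf.closed (single_lastVertex_mem hs) hx, Pi.zero_apply,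
      sub_zero]

end IsRelativeCocycle

theorem isRelativePrimitive_zero_empty (f : LocalForm (∅ : Finset V) (k + 1)) :
    IsRelativePrimitive 0 f where
  smooth := .zero
  vanishesOnBoundary := fun _ hj => absurd hj (Finset.notMem_empty _)
  extD_eqOn := fun _ hx => absurd (nonempty_of_mem_closedSimplex hx) Finset.not_nonempty_empty

theorem exists_relative_primitive (s : Finset V) (k : ℕ) :
    ∃ C : ℝ, 0 ≤ C ∧ ∀ f : LocalForm s (k + 1), f.IsRelativeCocycle →
      ∃ g : LocalForm s k, g.IsRelativePrimitive f ∧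
        ∀ M : ℝ, BoundedBy f M → BoundedBy g (C * M) := by
  induction k generalizing s with
  | zero =>
    refine ⟨2, zero_le_two, fun f hf => ?_⟩
    rcases s.eq_empty_or_nonempty with rfl | hne
    · exact ⟨0, isRelativePrimitive_zero_empty f, fun _ _ _ hx =>
        absurd (nonempty_of_mem_closedSimplex hx) Finset.not_nonempty_empty⟩
    obtain ⟨n, hs⟩ := Nat.exists_eq_add_one.2 hne.card_pos
    refine ⟨coneOp (EuclideanSpace.single (lastVertex s hs) 1) f - 0,
      hf.isRelativePrimitive_coneOp_sub hs .zero (fun _ => extD_eq_zero fun _ _ => rfl)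
        (fun _ hx => ((hf.faceRes_coneOp hs).eq_zero hx).symm) fun _ _ _ _ _ => rfl,
      fun M hM => ?_⟩
    rw [sub_zero]
    exact hM.coneOp (single_lastVertex_mem hs)
  | succ k ih =>
    rcases s.eq_empty_or_nonempty with rfl | hne
    · exact ⟨0, le_rfl, fun f _ => ⟨0, isRelativePrimitive_zero_empty f, fun _ _ _ hx =>
        absurd (nonempty_of_mem_closedSimplex hx) Finset.not_nonempty_empty⟩⟩
    obtain ⟨n, hs⟩ := Nat.exists_eq_add_one.2 hne.card_pos
    have hp := single_lastVertex_mem hs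
    obtain ⟨C₁, hC₁, hprim⟩ := ih (s.erase (lastVertex s hs))
    obtain ⟨C₂, hC₂, hext⟩ := exists_boundedBy_faceExt s (lastVertex s hs) k
    refine ⟨2 + C₂ * (2 * C₁ + 2), by positivity, fun f hf => ?_⟩
    obtain ⟨γ, hγ, hγM⟩ := hprim _ (hf.faceRes_coneOp hs)
    refine ⟨coneOp (EuclideanSpace.single (lastVertex s hs) 1) f - extD (faceExt _ γ),
      hf.isRelativePrimitive_coneOp_sub hs hγ.smooth.faceExt.extD
        (fun _ => extD_extD hγ.smooth.faceExt)
        ((faceRes_extD_faceExt_erase hγ.smooth).trans hγ.extD_eqOn)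
        fun j hj hjq => hγ.vanishesOnBoundary.faceRes_extD_faceExt hγ.smooth hj hjq, fun M hM => ?_⟩
    have hM0 : 0 ≤ M := hM.nonneg hp
    have hcone : BoundedBy (faceRes (s.erase_subset (lastVertex s hs)) _) (2 * M) :=
      (hM.coneOp hp).faceRes _
    have hbound : BoundedBy (extD (faceExt _ γ)) (C₂ * (2 * C₁ * M + 2 * M)) :=
      (hext γ hγ.smooth _ (by positivity)
        ((hγM _ hcone).mono (by linarith : _ ≤ 2 * C₁ * M + 2 * M))
        ((hcone.congr hγ.extD_eqOn).mono (le_add_of_nonneg_left (by positivity)))).2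
    exact ((hM.coneOp hp).sub hbound).mono (by linarith)

section BoundaryForm

variable {V : Type*} [Fintype V] [DecidableEq V] {s : Finset V} {k : ℕ}
  {b : ∀ j : V, LocalForm (s.erase j) k} {e : LocalForm s k} {i j : V}

/-- A form on the boundary of the simplex: a family of smooth forms on the codimension one faces,
`b j` on the face opposite to `j`, that agree on common faces. -/
structure IsBoundaryForm (b : ∀ j : V, LocalForm (s.erase j) k) : Prop where
  smooth : ∀ j ∈ s, (b j).IsSmooth
  compatible : ∀ i ∈ s, ∀ j ∈ s, ∀ (t : Finset V) (hi : t ⊆ s.erase i) (hj : t ⊆ s.erase j),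
    EqOn (faceRes hi (b i)) (faceRes hj (b j)) (closedSimplex t)

theorem faceRes_add_faceExt_erase (b : LocalForm (s.erase i) k) (e : LocalForm s k) :
    EqOn (faceRes (s.erase_subset i) (e + faceExt i (b - faceRes (s.erase_subset i) e))) b
      (closedSimplex (s.erase i)) := fun x hx => by
  rw [faceRes_add, Pi.add_apply, faceRes_faceExt_erase _ hx,
    Pi.sub_apply, add_sub_cancel]

theorem IsBoundaryForm.faceRes_add_faceExt (hb : IsBoundaryForm b) (hi : i ∈ s) (hj : j ∈ s)
    (hej : EqOn (faceRes (s.erase_subset j) e) (b j) (closedSimplex (s.erase j))) :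
    EqOn (faceRes (s.erase_subset j) (e + faceExt i (b i - faceRes (s.erase_subset i) e))) (b j)
      (closedSimplex (s.erase j)) := fun x hx => by
  have hi' := Finset.erase_subset_erase i (s.erase_subset j)
  have hj' := Finset.erase_subset i (s.erase j)
  have hzero : EqOn (faceRes hi' (b i - faceRes (s.erase_subset i) e)) 0
      (closedSimplex ((s.erase j).erase i)) := fun y hy => by
    rw [faceRes_sub, Pi.sub_apply, Pi.zero_apply, sub_eq_zero]
    exact (hb.compatible i hi j hj _ hi' hj' hy).trans
      (faceRes_congr hj' (hej.mono (closedSimplex_mono hj')) hy).symm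
  rw [faceRes_add, Pi.add_apply]
  exact (congrArg₂ (· + ·) (hej hx) (faceRes_faceExt_eq_zero _ hzero hx)).trans (add_zero _)

theorem exists_boundedBy_partial_extension (k : ℕ) {R : Finset V} (hR : R ⊆ s) :
    ∃ C : ℝ, 0 ≤ C ∧ ∀ b : ∀ j : V, LocalForm (s.erase j) k, IsBoundaryForm b →
      ∃ e : LocalForm s k, e.IsSmooth ∧
        (∀ j ∈ R, EqOn (faceRes (s.erase_subset j) e) (b j) (closedSimplex (s.erase j))) ∧
        ∀ M : ℝ, 0 ≤ M → (∀ j ∈ s, BoundedBy (b j) M) → (∀ j ∈ s, BoundedBy (extD (b j)) M) →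
          BoundedBy e (C * M) ∧ BoundedBy (extD e) (C * M) := by
  induction R using Finset.induction_on with
  | empty =>
    refine ⟨0, le_rfl, fun b _ => ⟨0, .zero, by simp, fun M _ _ _ => ?_⟩⟩
    rw [zero_mul]
    exact ⟨.zero, BoundedBy.zero.congr fun _ => extD_eq_zero fun _ _ => rfl⟩
  | insert i R _ ih =>
    obtain ⟨hi, hRs⟩ := Finset.insert_subset_iff.1 hR
    obtain ⟨C, hC, hpart⟩ := ih hRs
    obtain ⟨C', hC', hext⟩ := exists_boundedBy_faceExt s i k
    refine ⟨C + C' * (1 + C), by positivity, fun b hb => ?_⟩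
    obtain ⟨e, he, heb, heM⟩ := hpart b hb
    have hres := he.faceRes (s.erase_subset i)
    have hc : (b i - faceRes (s.erase_subset i) e).IsSmooth := (hb.smooth i hi).sub hres
    refine ⟨e + faceExt i (b i - faceRes (s.erase_subset i) e), he.add hc.faceExt,
      fun j hj => ?_, fun M hM hbM hdM => ?_⟩
    · rcases Finset.mem_insert.1 hj with rfl | hjR
      · exact faceRes_add_faceExt_erase (b j) e
      · exact hb.faceRes_add_faceExt hi (hRs hjR) (heb j hjR)
    · obtain ⟨heM, hedM⟩ := heM M hM hbM hdM
      have hd : EqOn (extD (b i - faceRes (s.erase_subset i) e))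
          (extD (b i) - faceRes (s.erase_subset i) (extD e)) (closedSimplex (s.erase i)) :=
        fun y hy => by rw [extD_sub (hb.smooth i hi) hres hy, extD_faceRes _ he hy, Pi.sub_apply]
      obtain ⟨hextM, hdextM⟩ := hext _ hc (M + C * M) (by positivity)
        ((hbM i hi).sub (heM.faceRes _)) (((hdM i hi).sub (hedM.faceRes _)).congr hd)
      have hconst : C * M + C' * (M + C * M) = (C + C' * (1 + C)) * M := by ring
      rw [← hconst]
      exact ⟨heM.add hextM, (hedM.add hdextM).congr fun _ => extD_add he hc.faceExt⟩

end BoundaryForm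

theorem exists_primitive_extending (s : Finset V) (k : ℕ) :
    ∃ C : ℝ, 0 ≤ C ∧ ∀ (f : LocalForm s (k + 1)) (b : ∀ j : V, LocalForm (s.erase j) k),
      f.IsSmooth → EqOn (extD f) 0 (closedSimplex s) → IsBoundaryForm b →
      (∀ j ∈ s, EqOn (extD (b j)) (faceRes (s.erase_subset j) f) (closedSimplex (s.erase j))) →
      (∀ hs : s.card = k + 2, f.integral hs = boundaryIntegral hs b) →
      ∃ g : LocalForm s k, g.IsSmooth ∧
        (∀ j ∈ s, EqOn (faceRes (s.erase_subset j) g) (b j) (closedSimplex (s.erase j))) ∧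
        EqOn (extD g) f (closedSimplex s) ∧
        ∀ M : ℝ, BoundedBy f M → (∀ j ∈ s, BoundedBy (b j) M) → BoundedBy g (C * M) := by
  obtain ⟨C₁, hC₁, hprim⟩ := exists_relative_primitive s k
  obtain ⟨C₂, hC₂, hext⟩ := exists_boundedBy_partial_extension k (subset_refl s)
  refine ⟨C₂ + C₁ * (1 + C₂), by positivity, fun f b hf hd hb hbd hint => ?_⟩
  obtain ⟨e, he, heb, heM⟩ := hext b hb
  have hcocycle : (f - extD e).IsRelativeCocycle :=
    { smooth := hf.sub he.extD
      closed := fun x hx => by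
        rw [extD_sub hf he.extD hx, hd hx, extD_extD he hx, Pi.zero_apply, sub_zero]
      vanishesOnBoundary := fun j hj x hx => by
        rw [faceRes_sub, Pi.sub_apply, ← extD_faceRes _ he hx,
          ← hbd j hj hx, extD_congr (heb j hj) hx, sub_self, Pi.zero_apply]
      integral_eq_zero := fun hs => by
        rw [integral_sub hs hf he.extD, hint hs, integral_extD hs he, sub_eq_zero]
        exact (boundaryIntegral_congr hs heb).symm }
  obtain ⟨g, hg, hgM⟩ := hprim _ hcocycle
  refine ⟨e + g, he.add hg.smooth, fun j hj x hx => ?_, fun x hx => ?_, fun M hfM hbM x hx => ?_⟩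
  · rw [faceRes_add, Pi.add_apply, heb j hj hx,
      hg.vanishesOnBoundary j hj hx, Pi.zero_apply, add_zero]
  · rw [extD_add he hg.smooth hx, hg.extD_eqOn hx, Pi.sub_apply, add_sub_cancel]
  · obtain ⟨heM, hedM⟩ := heM M (hfM.nonneg hx) hbM fun j hj =>
      (hfM.faceRes _).congr (hbd j hj)
    exact ((heM.add (hgM _ (hfM.sub hedM))).mono (by linarith)) x hx

end LocalForm

end LocalPoincare

/-! ### Simplexwise forms -/

section Families

open LocalForm

variable {V : Type*} [Fintype V] [DecidableEq V] {X A : PreAbstractSimplicialComplex V} {k : ℕ}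

/-- A simplexwise smooth form on `X` that vanishes on `A`, as a family of forms indexed by all
finite sets of vertices; the members of the family outside `X` are irrelevant. -/
structure IsRelativeForm (X A : PreAbstractSimplicialComplex V)
    (f : ∀ s : Finset V, LocalForm s k) : Prop where
  smooth : ∀ s ∈ X.faces, (f s).IsSmooth
  compatible : ∀ s ∈ X.faces, ∀ (t : Finset V) (h : t ⊆ s),
    EqOn (faceRes h (f s)) (f t) (closedSimplex t)
  vanishes : ∀ s ∈ A.faces, EqOn (f s) 0 (closedSimplex s)

namespace IsRelativeForm

variable {f g : ∀ s : Finset V, LocalForm s k}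

theorem zero : IsRelativeForm X A (0 : ∀ s : Finset V, LocalForm s k) where
  smooth := fun _ _ => .zero
  compatible := fun _ _ _ h _ _ => pullback_apply_eq_zero (isSimplexMap_id h) rfl
  vanishes := fun _ _ _ _ => rfl

theorem add (hf : IsRelativeForm X A f) (hg : IsRelativeForm X A g) :
    IsRelativeForm X A (f + g) where
  smooth := fun s hs => (hf.smooth s hs).add (hg.smooth s hs)
  compatible := fun s hs t h _ hx =>
    congrArg₂ (· + ·) (hf.compatible s hs t h hx) (hg.compatible s hs t h hx)
  vanishes := fun s hs _ hx =>
    (congrArg₂ (· + ·) (hf.vanishes s hs hx) (hg.vanishes s hs hx)).trans (add_zero _)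

theorem const_smul (c : ℝ) (hf : IsRelativeForm X A f) : IsRelativeForm X A (c • f) where
  smooth := fun s hs => (hf.smooth s hs).const_smul c
  compatible := fun s hs t h _ hx => congrArg (c • ·) (hf.compatible s hs t h hx)
  vanishes := fun s hs _ hx => (congrArg (c • ·) (hf.vanishes s hs hx)).trans (smul_zero c)

theorem extD (hf : IsRelativeForm X A f) : IsRelativeForm X A fun s => extD (f s) where
  smooth := fun s hs => (hf.smooth s hs).extD
  compatible := fun s hs t h _ hx =>
    (extD_faceRes h (hf.smooth s hs) hx).symm.trans (extD_congr (hf.compatible s hs t h) hx)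
  vanishes := fun s hs _ hx => extD_eq_zero (hf.vanishes s hs) hx

end IsRelativeForm

/-- The space of simplexwise smooth `k`-forms on `X` that vanish on `A`. -/
def relForms (X A : PreAbstractSimplicialComplex V) (k : ℕ) :
    Submodule ℝ (∀ s : Finset V, LocalForm s k) where
  carrier := {f | IsRelativeForm X A f}
  add_mem' := .add
  zero_mem' := .zero
  smul_mem' := fun c _ hf => hf.const_smul c

namespace SimplexwiseForm

theorem eqOn_faceRes_toFun (a : SimplexwiseForm X k) {s t : Finset V} (hs : s ∈ X.faces)
    (h : t ⊆ s) : EqOn (faceRes h (a.toFun s)) (a.toFun t) (closedSimplex t) := fun x hx => by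
  ext w
  exact a.compatible t ((X.isRelLowerSet_faces hs).2 h (nonempty_of_mem_closedSimplex hx))
    s hs h x hx w

theorem isRelativeForm_toFun (a : SimplexwiseForm X k) {hAX : A ≤ X}
    (ha : (a.restrict hAX).IsZero) : IsRelativeForm X A a.toFun :=
  ⟨a.smooth, fun _ hs _ h => a.eqOn_faceRes_toFun hs h, ha⟩

theorem isPrimitiveOf_iff {a : SimplexwiseForm X k} {b : SimplexwiseForm X (k + 1)} :
    a.IsPrimitiveOf b ↔ ∀ s ∈ X.faces, EqOn (extD (a.toFun s)) (b.toFun s) (closedSimplex s) := by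
  refine ⟨fun h s hs x hx => ?_, fun h s hs v hv => ?_⟩
  · exact (h s hs _ (unchart_mem hx)).trans (by rw [chart_unchart hx])
  · rw [← h s hs hv, extD, unchart_chart]
    rfl

theorem isClosedForm_iff {a : SimplexwiseForm X k} :
    a.IsClosedForm ↔ ∀ s ∈ X.faces, EqOn (extD (a.toFun s)) 0 (closedSimplex s) := by
  refine ⟨fun h s hs x hx => h s hs _ (unchart_mem hx), fun h s hs v hv => ?_⟩
  have hv0 : extD (a.toFun s) (chart s v) = 0 := h s hs hv
  rw [← hv0, extD, unchart_chart]
  rfl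

theorem boundedBy_toReal (a : SimplexwiseForm X k) {N : ℝ≥0∞} (hN : N ≠ ⊤) (h : a.supNorm ≤ N)
    {s : Finset V} (hs : s ∈ X.faces) : BoundedBy (a.toFun s) N.toReal := fun x hx => by
  have henorm : ‖a.toFun s x‖ₑ ≤ N := by
    simp only [supNorm, iSup_le_iff] at h
    exact h s hs x hx
  exact (toReal_enorm (a.toFun s x)).symm.trans_le (ENNReal.toReal_mono hN henorm)

theorem IsZero.supNorm_eq_zero {a : SimplexwiseForm X k} (h : a.IsZero) : a.supNorm = 0 := by
  simp only [supNorm, ENNReal.iSup_eq_zero]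
  intro s hs x hx
  rw [← ofReal_norm, ENNReal.ofReal_eq_zero]
  exact BoundedBy.zero.congr (h s hs) x hx

-- The summand `1` is needed only for `C = 0` and `N = ⊤`, because `0 * ⊤ = 0`.
theorem supNorm_le (a : SimplexwiseForm X k) {N : ℝ≥0∞} {C : ℝ} (hC : 0 ≤ C)
    (h : N ≠ ⊤ → ∀ s ∈ X.faces, BoundedBy (a.toFun s) (C * N.toReal)) :
    a.supNorm ≤ ((C.toNNReal + 1 : ℝ≥0) : ℝ≥0∞) * N := by
  rcases eq_or_ne N ⊤ with rfl | hN
  · rw [ENNReal.mul_top (by simp)]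
    exact le_top
  refine iSup₂_le fun s hs => iSup₂_le fun x hx => ?_
  calc ‖a.toFun s x‖ₑ = ENNReal.ofReal ‖a.toFun s x‖ := (ofReal_norm _).symm
    _ ≤ ENNReal.ofReal (C * N.toReal) := ENNReal.ofReal_le_ofReal (h hN s hs x hx)
    _ = C.toNNReal * N := by rw [ENNReal.ofReal_mul hC, ENNReal.ofReal_toReal hN]; rfl
    _ ≤ ((C.toNNReal + 1 : ℝ≥0) : ℝ≥0∞) * N := by
      gcongr
      exact le_add_of_nonneg_right zero_le_one

variable (X) in
/-- The simplexwise form on `X` obtained by restricting a form on the simplex of all vertices. -/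
def ofUniv (g : LocalForm (Finset.univ : Finset V) k) (hg : g.IsSmooth) : SimplexwiseForm X k where
  toFun := fun t => faceRes t.subset_univ g
  smooth := fun t _ => hg.faceRes t.subset_univ
  compatible := fun _ _ _ _ _ _ _ _ => rfl

end SimplexwiseForm

end Families

section StandardSimplex

open LocalForm

variable {n k : ℕ}

theorem erase_mem_bdryComplex (hn : 0 < n) (j : Fin (n + 1)) :
    Finset.univ.erase j ∈ (bdryComplex n).faces := by
  refine ⟨?_, (Finset.erase_ssubset (Finset.mem_univ j)).ne⟩
  rw [← Finset.card_pos, Finset.card_erase_of_mem (Finset.mem_univ j), Finset.card_fin]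
  exact hn

theorem exists_subset_erase_of_mem_bdryComplex {t : Finset (Fin (n + 1))}
    (ht : t ∈ (bdryComplex n).faces) : ∃ j, t ⊆ Finset.univ.erase j := by
  obtain ⟨j, -, hjt⟩ := Finset.exists_of_ssubset (t.ssubset_univ_iff.2 ht.2)
  exact ⟨j, Finset.subset_erase.2 ⟨t.subset_univ, hjt⟩⟩

theorem boundaryIntegral_toFun (b : SimplexwiseForm (bdryComplex n) k)
    (hs : (Finset.univ : Finset (Fin (n + 1))).card = k + 2) (hn : k + 1 = n) :
    (boundaryIntegral hs fun j => b.toFun (Finset.univ.erase j)) = bdryIntegral b hn := by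
  subst hn
  refine Finset.sum_congr rfl fun i _ => congrArg _ ?_
  have hi : Finset.univ.orderEmbOfFin hs i = i :=
    (congrFun (Finset.orderEmbOfFin_unique hs (f := id) (fun _ => Finset.mem_univ _)
      strictMono_id) i).symm
  have hface : ∀ (j : Fin (k + 1 + 1)) (hj : (Finset.univ.erase j).card = k + 1)
      (hi : (Finset.univ.erase i).card = k + 1), j = i →
      LocalForm.integral hj (b.toFun (Finset.univ.erase j)) =
        LocalForm.integral hi (b.toFun (Finset.univ.erase i)) := by
    rintro j _ _ rfl
    rfl
  exact hface _ _ (by simp) hi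

theorem SimplexwiseForm.isBoundaryForm_toFun (b : SimplexwiseForm (bdryComplex n) k)
    (hn : 0 < n) : IsBoundaryForm fun j => (b.toFun (Finset.univ.erase j) : LocalForm _ k) where
  smooth := fun j _ => b.smooth _ (erase_mem_bdryComplex hn j)
  compatible := fun i _ j _ _ hi hj _ hx =>
    (b.eqOn_faceRes_toFun (erase_mem_bdryComplex hn i) hi hx).trans
      (b.eqOn_faceRes_toFun (erase_mem_bdryComplex hn j) hj hx).symm

theorem exists_primitive_extending_stdComplex (hn : 0 < n) (k : ℕ) :
    ∃ C : ℝ≥0, ∀ (η : SimplexwiseForm (stdComplex n) (k + 1))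
      (b : SimplexwiseForm (bdryComplex n) k),
      η.IsClosedForm → b.IsPrimitiveOf (η.restrict (bdryComplex_le n)) →
      (∀ h : k + 1 = n, stdIntegral η h = bdryIntegral b h) →
      ∃ a : SimplexwiseForm (stdComplex n) k,
        (a.restrict (bdryComplex_le n)).Agrees b ∧ a.IsPrimitiveOf η ∧
        a.supNorm ≤ C * (η.supNorm + b.supNorm) := by
  obtain ⟨C, hC, hext⟩ := exists_primitive_extending (Finset.univ : Finset (Fin (n + 1))) k
  refine ⟨C.toNNReal + 1, fun η b hη hb hint => ?_⟩
  have huniv : (Finset.univ : Finset (Fin (n + 1))) ∈ (stdComplex n).faces := Finset.univ_nonempty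
  have herase := erase_mem_bdryComplex hn
  obtain ⟨g, hg, hgb, hgd, hgM⟩ := hext (η.toFun Finset.univ)
    (fun j => b.toFun (Finset.univ.erase j)) (η.smooth _ huniv)
    (SimplexwiseForm.isClosedForm_iff.1 hη _ huniv) (b.isBoundaryForm_toFun hn)
    (fun j _ x hx => (SimplexwiseForm.isPrimitiveOf_iff.1 hb _ (herase j) hx).trans
      (η.eqOn_faceRes_toFun huniv (Finset.erase_subset _ _) hx).symm)
    (fun hs => by
      have hkn : k + 1 = n := by simpa using hs.symm
      exact (hint hkn).trans (boundaryIntegral_toFun b hs hkn).symm)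
  refine ⟨.ofUniv _ g hg, fun t ht x hx => ?_,
    SimplexwiseForm.isPrimitiveOf_iff.2 fun t _ x hx => ?_,
    SimplexwiseForm.supNorm_le _ hC fun hN t _ => ?_⟩
  · obtain ⟨j, htj⟩ := exists_subset_erase_of_mem_bdryComplex ht
    exact (faceRes_congr htj
      ((hgb j (Finset.mem_univ j)).mono (closedSimplex_mono htj)) hx).trans
      (b.eqOn_faceRes_toFun (herase j) htj hx)
  · exact (extD_faceRes _ hg hx).trans ((faceRes_congr _ (hgd.mono
      (closedSimplex_mono t.subset_univ)) hx).trans (η.eqOn_faceRes_toFun huniv t.subset_univ hx))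
  · exact (hgM _ (η.boundedBy_toReal hN le_self_add huniv) fun j _ =>
      b.boundedBy_toReal hN le_add_self (herase j)).faceRes t.subset_univ

theorem exists_primitive_vanishing_on_bdryComplex (hn : 0 < n) (k : ℕ) :
    ∃ C : ℝ≥0, ∀ η : SimplexwiseForm (stdComplex n) (k + 1),
      η.IsClosedForm → (η.restrict (bdryComplex_le n)).IsZero →
      (∀ h : k + 1 = n, stdIntegral η h = 0) →
      ∃ a : SimplexwiseForm (stdComplex n) k,
        (a.restrict (bdryComplex_le n)).IsZero ∧ a.IsPrimitiveOf η ∧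
        a.supNorm ≤ C * η.supNorm := by
  obtain ⟨C, hC⟩ := exists_primitive_extending_stdComplex hn k
  refine ⟨C, fun η hη hη0 hint => ?_⟩
  let b : SimplexwiseForm (bdryComplex n) k := .ofUniv _ 0 .zero
  have hb : ∀ t x, b.toFun t x = 0 := fun t _ =>
    pullback_apply_eq_zero (isSimplexMap_id t.subset_univ) rfl
  have hbη : b.IsPrimitiveOf (η.restrict (bdryComplex_le n)) :=
    SimplexwiseForm.isPrimitiveOf_iff.2 fun s hs x hx =>
      (extD_eq_zero (fun _ _ => hb s _) hx).trans (hη0 s hs x hx).symm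
  have hbint : ∀ h : k + 1 = n, stdIntegral η h = bdryIntegral b h := fun h => by
    simp [hint h, bdryIntegral, SimplexwiseForm.integral, hb]
  have hb0 : b.IsZero := fun t _ x _ => hb t x
  obtain ⟨a, ha, haη, haM⟩ := hC η b hη hbη hbint
  rw [hb0.supNorm_eq_zero, add_zero] at haM
  exact ⟨a, fun s hs x hx => (ha s hs x hx).trans (hb s x), haη, haM⟩

end StandardSimplex

/-! ### Correction of periods -/

section UniformBounds

theorem exists_common_bound {ι : Type*} [Finite ι] {P : ι → ℝ → Prop}
    (hmono : ∀ i C C', C ≤ C' → P i C → P i C') (h : ∀ i, ∃ C, P i C) :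
    ∃ C : ℝ, 0 ≤ C ∧ ∀ i, P i C := by
  choose C hC using h
  obtain ⟨B, hB⟩ := (Set.finite_range C).bddAbove
  exact ⟨max B 0, le_max_right _ _, fun i =>
    hmono i _ _ ((hB (mem_range_self i)).trans (le_max_left _ _)) (hC i)⟩

theorem exists_linear_generalizedInverse {K E F : Type*} [DivisionRing K] [AddCommGroup E]
    [Module K E] [AddCommGroup F] [Module K F] (φ : E →ₗ[K] F) :
    ∃ σ : F →ₗ[K] E, ∀ v, φ (σ (φ v)) = φ v := by
  obtain ⟨σ, hσ⟩ := φ.rangeRestrict.exists_rightInverse_of_surjective φ.range_rangeRestrict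
  obtain ⟨τ, hτ⟩ := σ.exists_extend
  refine ⟨τ, fun v => ?_⟩
  have hτσ : τ (φ v) = σ (φ.rangeRestrict v) := LinearMap.congr_fun hτ (φ.rangeRestrict v)
  rw [hτσ]
  exact congrArg Subtype.val (LinearMap.congr_fun hσ (φ.rangeRestrict v))

theorem exists_uniform_bound_of_finiteDimensional {𝕜 E F ι : Type*} [NontriviallyNormedField 𝕜]
    [CompleteSpace 𝕜] [NormedAddCommGroup E] [NormedSpace 𝕜 E] [FiniteDimensional 𝕜 E]
    [SeminormedAddCommGroup F] [NormedSpace 𝕜 F] (L : ι → E →ₗ[𝕜] F)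
    (h : ∀ v, ∃ C, ∀ i, ‖L i v‖ ≤ C) : ∃ C : ℝ, ∀ i v, ‖L i v‖ ≤ C * ‖v‖ := by
  have : CompleteSpace E := FiniteDimensional.complete 𝕜 E
  obtain ⟨C, hC⟩ := banach_steinhaus (g := fun i => LinearMap.toContinuousLinearMap (L i)) h
  exact ⟨C, fun i v => (LinearMap.toContinuousLinearMap (L i)).le_of_opNorm_le (hC i) v⟩

end UniformBounds

section PeriodCorrection

namespace LocalForm

section LinearFamilies

variable {V : Type*} [Fintype V] [DecidableEq V] {s : Finset V} {k : ℕ}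
  {E : Type*} [NormedAddCommGroup E] [NormedSpace ℝ E] [FiniteDimensional ℝ E]

theorem IsSmooth.exists_norm_le {f : LocalForm s k} (hf : f.IsSmooth) :
    ∃ C, ∀ x : closedSimplex s, ‖f x‖ ≤ C := by
  obtain ⟨C, hC⟩ := IsCompact.exists_bound_of_continuousOn
    (E := simplexDir s [⋀^Fin k]→L[ℝ] ℝ) (f := f) (isCompact_closedSimplex s) hf.continuousOn
  exact ⟨C, fun x => hC x x.2⟩

theorem exists_boundedBy_of_linear (f : E → LocalForm s k) (hf : ∀ v, (f v).IsSmooth)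
    (hadd : ∀ v w, EqOn (f (v + w)) (f v + f w) (closedSimplex s))
    (hsmul : ∀ (c : ℝ) v, EqOn (f (c • v)) (c • f v) (closedSimplex s)) :
    ∃ C : ℝ, ∀ v, BoundedBy (f v) (C * ‖v‖) := by
  let L (x : closedSimplex s) : E →ₗ[ℝ] simplexDir s [⋀^Fin k]→L[ℝ] ℝ :=
    { toFun := fun v => f v x
      map_add' := fun v w => hadd v w x.2
      map_smul' := fun c v => hsmul c v x.2 }
  obtain ⟨C, hC⟩ := exists_uniform_bound_of_finiteDimensional
    (𝕜 := ℝ) (E := E) (F := simplexDir s [⋀^Fin k]→L[ℝ] ℝ) L fun v => (hf v).exists_norm_le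
  exact ⟨C, fun v x hx => hC ⟨x, hx⟩ v⟩

end LinearFamilies

section Integral

open MeasureTheory

variable {V : Type*} [Fintype V] [LinearOrder V] {s : Finset V} {k : ℕ}

theorem exists_abs_integral_le (hs : s.card = k + 1) :
    ∃ C : ℝ, ∀ (f : LocalForm s k) (M : ℝ), BoundedBy f M → |f.integral hs| ≤ C * M := by
  refine ⟨(∏ j, ‖edges s hs j‖) * volume.real (coordSimplex k), fun f M hM => ?_⟩
  have hpt : ∀ y ∈ coordSimplex k,
      ‖f (simplexPt s hs y) (edges s hs)‖ ≤ M * ∏ j, ‖edges s hs j‖ := fun y hy =>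
    ((f (simplexPt s hs y)).le_opNorm _).trans
      (mul_le_mul_of_nonneg_right (hM _ (simplexPt_mem hs hy)) (by positivity))
  rw [← Real.norm_eq_abs]
  exact (norm_setIntegral_le_of_norm_le_const (isCompact_coordSimplex k).measure_lt_top hpt).trans
    (by ring : _ = _).le

end Integral

end LocalForm

open LocalForm

variable {V : Type*} [Fintype V] [LinearOrder V] {X A : PreAbstractSimplicialComplex V} {k : ℕ}

variable (X A k) in
/-- The integrals of the derivative of a `k`-form over the `(k + 1)`-simplices of `X`. -/
def periods : relForms X A k →ₗ[ℝ] ({s // s ∈ X.faces ∧ s.card = k + 2} → ℝ) where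
  toFun f s := (extD (f.1 s.1)).integral s.2.2
  map_add' f g := funext fun s =>
    (integral_congr s.2.2 fun _ => extD_add (f.2.smooth s s.2.1) (g.2.smooth s s.2.1)).trans
      (integral_add s.2.2 (f.2.smooth s s.2.1).extD (g.2.smooth s s.2.1).extD)
  map_smul' c f := funext fun s =>
    (integral_congr s.2.2 fun _ => extD_const_smul c (f.1 s)).trans
      (integral_const_smul s.2.2 c (extD (f.1 s)))

variable (X A k) in
theorem exists_abs_periods_le :
    ∃ C : ℝ, 0 ≤ C ∧ ∀ s (f : relForms X A k) (M : ℝ), 0 ≤ M →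
      (∀ t ∈ X.faces, BoundedBy (extD (f.1 t)) M) → |periods X A k f s| ≤ C * M := by
  refine exists_common_bound (fun _ C C' hC h f M hM hfM =>
    (h f M hM hfM).trans (mul_le_mul_of_nonneg_right hC hM)) fun s => ?_
  obtain ⟨C, hC⟩ := exists_abs_integral_le s.2.2
  exact ⟨C, fun f M _ hfM => hC _ M (hfM s s.2.1)⟩

theorem exists_boundedBy_relForms_of_linear {E : Type*} [NormedAddCommGroup E] [NormedSpace ℝ E]
    [FiniteDimensional ℝ E] (σ : E →ₗ[ℝ] relForms X A k) :
    ∃ C : ℝ, 0 ≤ C ∧ ∀ s ∈ X.faces, ∀ v,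
      BoundedBy ((σ v).1 s) (C * ‖v‖) ∧ BoundedBy (extD ((σ v).1 s)) (C * ‖v‖) := by
  suffices h : ∃ C : ℝ, 0 ≤ C ∧ ∀ (s : {s // s ∈ X.faces}) v,
      BoundedBy ((σ v).1 s) (C * ‖v‖) ∧ BoundedBy (extD ((σ v).1 s)) (C * ‖v‖) by
    simpa using h
  refine exists_common_bound (fun _ C C' hC h v => ?_) fun ⟨s, hs⟩ => ?_
  · have hv := mul_le_mul_of_nonneg_right hC (norm_nonneg v)
    exact ⟨(h v).1.mono hv, (h v).2.mono hv⟩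
  have hσ := fun v => (σ v).2.smooth s hs
  obtain ⟨C, hC⟩ := exists_boundedBy_of_linear (fun v => (σ v).1 s) hσ
    (fun v w _ _ => by rw [map_add]; rfl) (fun c v _ _ => by rw [map_smul]; rfl)
  obtain ⟨C', hC'⟩ := exists_boundedBy_of_linear (fun v => extD ((σ v).1 s)) (fun v => (hσ v).extD)
    (fun v w _ hx => by rw [map_add]; exact extD_add (hσ v) (hσ w) hx)
    (fun c v _ hx => by rw [map_smul]; exact extD_const_smul c _ hx)
  exact ⟨max C C', fun v =>
    ⟨(hC v).mono (mul_le_mul_of_nonneg_right (le_max_left _ _) (norm_nonneg v)),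
      (hC' v).mono (mul_le_mul_of_nonneg_right (le_max_right _ _) (norm_nonneg v))⟩⟩

variable (X A k) in
theorem exists_bounded_period_correction :
    ∃ C : ℝ, 0 ≤ C ∧ ∀ f : relForms X A k, ∃ g : relForms X A k,
      periods X A k g = periods X A k f ∧
      ∀ M : ℝ, 0 ≤ M → (∀ s ∈ X.faces, BoundedBy (extD (f.1 s)) M) →
        ∀ s ∈ X.faces, BoundedBy (g.1 s) (C * M) ∧ BoundedBy (extD (g.1 s)) (C * M) := by
  classical
  obtain ⟨C₀, hC₀, hper⟩ := exists_abs_periods_le X A k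
  obtain ⟨σ, hσ⟩ := exists_linear_generalizedInverse (K := ℝ) (E := relForms X A k)
    (F := {s // s ∈ X.faces ∧ s.card = k + 2} → ℝ) (periods X A k)
  obtain ⟨C, hC, hbound⟩ := exists_boundedBy_relForms_of_linear σ
  refine ⟨C * C₀, by positivity, fun f => ⟨σ (periods X A k f), hσ f, fun M hM hfM s hs => ?_⟩⟩
  have hnorm : ‖periods X A k f‖ ≤ C₀ * M :=
    (pi_norm_le_iff_of_nonneg (by positivity)).2 fun t => hper t f M hM hfM
  have hconst : C * ‖periods X A k f‖ ≤ C * C₀ * M := by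
    rw [mul_assoc]
    gcongr
  exact ⟨(hbound s hs _).1.mono hconst, (hbound s hs _).2.mono hconst⟩

end PeriodCorrection

/-! ### Induction over skeleta -/

section SkeletalInduction

open LocalForm

section Dimension

variable {V : Type*} [Fintype V] {s : Finset V} {k : ℕ}

theorem finrank_simplexDir_lt (hs : s.Nonempty) : Module.finrank ℝ (simplexDir s) < s.card := by
  classical
  obtain ⟨p, hp⟩ := hs
  let φ : simplexDir s →ₗ[ℝ] (s.erase p → ℝ) :=
    { toFun := fun v i => v.1 i
      map_add' := fun _ _ => rfl
      map_smul' := fun _ _ => rfl }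
  have hφ : Function.Injective φ := by
    rw [injective_iff_map_eq_zero]
    intro v hv
    have hne : ∀ i, i ≠ p → v.1 i = 0 := fun i hi => by
      by_cases his : i ∈ s
      · exact congrFun hv ⟨i, Finset.mem_erase.2 ⟨hi, his⟩⟩
      · exact v.2.1 i his
    have hvp : v.1 p = 0 := by
      rw [← v.2.2, Finset.sum_eq_single p (fun i _ => hne i) (by simp)]
    ext i
    rcases eq_or_ne i p with rfl | hi
    exacts [hvp, hne i hi]
  calc Module.finrank ℝ (simplexDir s) ≤ Module.finrank ℝ (s.erase p → ℝ) :=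
      LinearMap.finrank_le_finrank_of_injective hφ
    _ = (s.erase p).card := by rw [Module.finrank_fintype_fun_eq_card, Fintype.card_coe]
    _ < s.card := Finset.card_erase_lt_of_mem hp

theorem LocalForm.eqOn_zero_of_card_le (f : LocalForm s k) (hs : s.card ≤ k) :
    EqOn f 0 (closedSimplex s) := fun x hx => by
  ext w
  refine (f x).toAlternatingMap.map_linearDependent w fun hw => ?_
  have hk := hw.fintype_card_le_finrank
  have hlt := finrank_simplexDir_lt (nonempty_of_mem_closedSimplex hx)
  rw [Fintype.card_fin] at hk
  omega

end Dimension

section Skeleton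

variable {V : Type*} {X : PreAbstractSimplicialComplex V} {m : ℕ} {s : Finset V}

/-- The `(m - 1)`-skeleton of `X`: the indexing is by the number of vertices of a face. -/
def skeleton (X : PreAbstractSimplicialComplex V) (m : ℕ) : PreAbstractSimplicialComplex V where
  faces := {s | s ∈ X.faces ∧ s.card ≤ m}
  isRelLowerSet_faces := fun _ hs =>
    ⟨(X.isRelLowerSet_faces hs.1).1, fun _ hts ht =>
      ⟨(X.isRelLowerSet_faces hs.1).2 hts ht, (Finset.card_le_card hts).trans hs.2⟩⟩

theorem skeleton_eq_self [Fintype V] (hm : Fintype.card V ≤ m) : skeleton X m = X := by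
  ext s
  exact and_iff_left (s.card_le_univ.trans hm)

theorem erase_mem_skeleton [DecidableEq V] (hs : s ∈ X.faces) (hm : s.card = m + 1) (hm0 : 0 < m)
    {j : V} (hj : j ∈ s) : s.erase j ∈ (skeleton X m).faces := by
  have hcard : (s.erase j).card = m := by
    rw [Finset.card_erase_of_mem hj, hm, Nat.add_sub_cancel]
  exact ⟨(X.isRelLowerSet_faces hs).2 (s.erase_subset j) (Finset.card_pos.1 (hcard ▸ hm0)),
    hcard.le⟩

theorem mem_skeleton_or_card_eq (hs : s ∈ (skeleton X (m + 1)).faces) :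
    s ∈ (skeleton X m).faces ∨ s.card = m + 1 :=
  (Nat.le_or_eq_of_le_succ hs.2).imp_left fun h => ⟨hs.1, h⟩

end Skeleton

section Glue

variable {V : Type*} [Fintype V] {k m : ℕ} {s : Finset V} {g e : ∀ s : Finset V, LocalForm s k}

/-- The family of forms that agrees with `g` on the simplices with at most `m` vertices and with
`e` on the others. -/
def glueAbove (m : ℕ) (g e : ∀ s : Finset V, LocalForm s k) : ∀ s : Finset V, LocalForm s k :=
  fun s => if s.card ≤ m then g s else e s

theorem glueAbove_of_le (hs : s.card ≤ m) : glueAbove m g e s = g s :=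
  if_pos hs

theorem glueAbove_of_lt (hs : m < s.card) : glueAbove m g e s = e s :=
  if_neg hs.not_ge

end Glue

variable {V : Type*} [Fintype V] [LinearOrder V] {X A : PreAbstractSimplicialComplex V}
  {k m : ℕ} {s : Finset V} {f : ∀ s : Finset V, LocalForm s (k + 1)}
  {g e : ∀ s : Finset V, LocalForm s k}

/-- A closed simplexwise form on `X` that vanishes on `A` and has integral zero over every simplex
of its own dimension. -/
structure IsPeriodFreeCocycle (X A : PreAbstractSimplicialComplex V)
    (f : ∀ s : Finset V, LocalForm s k) : Prop extends IsRelativeForm X A f where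
  extD_eq_zero : ∀ s ∈ X.faces, EqOn (extD (f s)) 0 (closedSimplex s)
  integral_eq_zero : ∀ s ∈ X.faces, ∀ hs : s.card = k + 1, (f s).integral hs = 0

/-- A primitive of `f`, relative to `A`, on the faces of `X` with at most `m` vertices. It vanishes
on the simplices of dimension `k`, so that it has integral zero over the boundary of every
`(k + 1)`-simplex, as extending it requires. -/
structure IsSkeletalPrimitive (X A : PreAbstractSimplicialComplex V) (m : ℕ)
    (f : ∀ s : Finset V, LocalForm s (k + 1)) (g : ∀ s : Finset V, LocalForm s k) : Prop
    extends IsRelativeForm (skeleton X m) (skeleton A m) g where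
  extD_eq : ∀ s ∈ (skeleton X m).faces, EqOn (extD (g s)) (f s) (closedSimplex s)
  eq_zero_of_card : ∀ s ∈ X.faces, s.card = k + 1 → EqOn (g s) 0 (closedSimplex s)

/-- The form `e` on the simplex `s` is a primitive of `f`, relative to `A`, that extends the forms
given by `g` on the facets of `s`. -/
structure IsPrimitiveOver (A : PreAbstractSimplicialComplex V)
    (f : ∀ s : Finset V, LocalForm s (k + 1)) (g : ∀ s : Finset V, LocalForm s k)
    (s : Finset V) (e : LocalForm s k) : Prop where
  smooth : e.IsSmooth
  faceRes_eq : ∀ j ∈ s, EqOn (faceRes (s.erase_subset j) e) (g (s.erase j))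
    (closedSimplex (s.erase j))
  extD_eq : EqOn (extD e) (f s) (closedSimplex s)
  vanishes : s ∈ A.faces → EqOn e 0 (closedSimplex s)

theorem IsSkeletalPrimitive.isBoundaryForm (hg : IsSkeletalPrimitive X A m f g)
    (hs : ∀ j ∈ s, s.erase j ∈ (skeleton X m).faces) : IsBoundaryForm fun j => g (s.erase j) where
  smooth := fun j hj => hg.smooth _ (hs j hj)
  compatible := fun i hi j hj t hti htj =>
    (hg.compatible _ (hs i hi) t hti).trans (hg.compatible _ (hs j hj) t htj).symm

theorem IsSkeletalPrimitive.boundaryIntegral_eq_zero (hg : IsSkeletalPrimitive X A m f g)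
    (hX : ∀ j ∈ s, s.erase j ∈ (skeleton X m).faces) (hs : s.card = k + 2) :
    boundaryIntegral hs (fun j => g (s.erase j)) = 0 :=
  Finset.sum_eq_zero fun i _ => by
    have hi := s.orderEmbOfFin_mem hs i
    rw [LocalForm.integral_eq_zero _ (hg.eq_zero_of_card _ (hX _ hi).1
      (card_erase_orderEmbOfFin hs i)), mul_zero]

theorem exists_isPrimitiveOver (hs : s ∈ X.faces) (hm : s.card = m + 1) (hm0 : 0 < m) :
    ∃ C : ℝ, 0 ≤ C ∧ ∀ (f : ∀ s : Finset V, LocalForm s (k + 1))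
        (g : ∀ s : Finset V, LocalForm s k),
      IsPeriodFreeCocycle X A f → IsSkeletalPrimitive X A m f g →
      ∃ e, IsPrimitiveOver A f g s e ∧ ∀ M : ℝ, BoundedBy (f s) M →
        (∀ j ∈ s, BoundedBy (g (s.erase j)) M) → BoundedBy e (C * M) := by
  by_cases hA : s ∈ A.faces
  · refine ⟨0, le_rfl, fun f g hf hg => ⟨0, ⟨.zero, fun j hj x hx => ?_, fun x hx => ?_,
      fun _ _ _ => rfl⟩, fun M _ _ => (zero_mul M).symm ▸ .zero⟩⟩
    · exact (pullback_apply_eq_zero (isSimplexMap_id (s.erase_subset j)) rfl).trans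
        (hg.vanishes _ (erase_mem_skeleton hA hm hm0 hj) hx).symm
    · exact (LocalForm.extD_eq_zero (fun _ _ => rfl) hx).trans (hf.vanishes s hA hx).symm
  obtain ⟨C, hC, hext⟩ := exists_primitive_extending s k
  refine ⟨C, hC, fun f g hf hg => ?_⟩
  have hX := fun j hj => erase_mem_skeleton hs hm hm0 (j := j) hj
  obtain ⟨e, he, heb, hed, heM⟩ := hext (f s) (fun j => g (s.erase j)) (hf.smooth s hs)
    (hf.extD_eq_zero s hs) (hg.isBoundaryForm hX)
    (fun j hj => (hg.extD_eq _ (hX j hj)).trans (hf.compatible s hs _ (s.erase_subset j)).symm)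
    fun hk => (hf.integral_eq_zero s hs hk).trans (hg.boundaryIntegral_eq_zero hX hk).symm
  exact ⟨e, ⟨he, heb, hed, fun h => absurd h hA⟩, heM⟩

variable (X A k) in
theorem exists_isPrimitiveOver_all (hm0 : 0 < m) :
    ∃ C : ℝ, 0 ≤ C ∧ ∀ (f : ∀ s : Finset V, LocalForm s (k + 1))
        (g : ∀ s : Finset V, LocalForm s k),
      IsPeriodFreeCocycle X A f → IsSkeletalPrimitive X A m f g →
      ∃ e : ∀ s : Finset V, LocalForm s k, ∀ s ∈ X.faces, s.card = m + 1 →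
        IsPrimitiveOver A f g s (e s) ∧ ∀ M : ℝ, 0 ≤ M → BoundedBy (f s) M →
          (∀ j ∈ s, BoundedBy (g (s.erase j)) M) → BoundedBy (e s) (C * M) := by
  obtain ⟨C, hC, hext⟩ := exists_common_bound (ι := {s // s ∈ X.faces ∧ s.card = m + 1})
    (P := fun s C => ∀ (f : ∀ s : Finset V, LocalForm s (k + 1))
        (g : ∀ s : Finset V, LocalForm s k),
      IsPeriodFreeCocycle X A f → IsSkeletalPrimitive X A m f g →
      ∃ e, IsPrimitiveOver A f g s e ∧ ∀ M : ℝ, 0 ≤ M → BoundedBy (f s) M →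
        (∀ j ∈ s.1, BoundedBy (g (s.1.erase j)) M) → BoundedBy e (C * M))
    (fun s C C' hCC h f g hf hg => by
      obtain ⟨e, he, heM⟩ := h f g hf hg
      exact ⟨e, he, fun M hM hfM hgM =>
        (heM M hM hfM hgM).mono (mul_le_mul_of_nonneg_right hCC hM)⟩)
    fun s => by
      obtain ⟨C, _, h⟩ := exists_isPrimitiveOver (A := A) (k := k) s.2.1 s.2.2 hm0
      refine ⟨C, fun f g hf hg => ?_⟩
      obtain ⟨e, he, heM⟩ := h f g hf hg
      exact ⟨e, he, fun M _ => heM M⟩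
  refine ⟨C, hC, fun f g hf hg => ?_⟩
  have hex : ∀ s ∈ X.faces, s.card = m + 1 → ∃ e : LocalForm s k,
      IsPrimitiveOver A f g s e ∧ ∀ M : ℝ, 0 ≤ M → BoundedBy (f s) M →
        (∀ j ∈ s, BoundedBy (g (s.erase j)) M) → BoundedBy e (C * M) :=
    fun s hs hm => hext ⟨s, hs, hm⟩ f g hf hg
  choose! e he using hex
  exact ⟨e, he⟩

theorem IsSkeletalPrimitive.compatible_glueAbove (hm : 0 < m) (hg : IsSkeletalPrimitive X A m f g)
    (he : ∀ s ∈ X.faces, s.card = m + 1 → IsPrimitiveOver A f g s (e s))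
    (hs : s ∈ (skeleton X (m + 1)).faces) {t : Finset V} (hts : t ⊆ s) :
    EqOn (faceRes hts (glueAbove m g e s)) (glueAbove m g e t) (closedSimplex t) := by
  rcases mem_skeleton_or_card_eq hs with h | h
  · rw [glueAbove_of_le h.2, glueAbove_of_le ((Finset.card_le_card hts).trans h.2)]
    exact hg.compatible s h t hts
  rcases hts.eq_or_ssubset with rfl | hlt
  · exact fun _ _ => rfl
  obtain ⟨j, hj, hjt⟩ := Finset.exists_of_ssubset hlt
  have htj : t ⊆ s.erase j := Finset.subset_erase.2 ⟨hts, hjt⟩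
  have hX := erase_mem_skeleton hs.1 h hm hj
  rw [glueAbove_of_lt h.ge, glueAbove_of_le ((Finset.card_le_card htj).trans hX.2)]
  have hface : EqOn (faceRes htj (faceRes (s.erase_subset j) (e s))) (faceRes htj (g (s.erase j)))
      (closedSimplex t) :=
    faceRes_congr htj (((he s hs.1 h).faceRes_eq j hj).mono (closedSimplex_mono htj))
  exact hface.trans (hg.compatible _ hX t htj)

theorem IsSkeletalPrimitive.glueAbove (hAX : A ≤ X) (hkm : k + 1 ≤ m)
    (hg : IsSkeletalPrimitive X A m f g)
    (he : ∀ s ∈ X.faces, s.card = m + 1 → IsPrimitiveOver A f g s (e s)) :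
    IsSkeletalPrimitive X A (m + 1) f (glueAbove m g e) where
  smooth := fun s hs => by
    rcases mem_skeleton_or_card_eq hs with h | h
    · exact glueAbove_of_le h.2 ▸ hg.smooth s h
    · exact glueAbove_of_lt h.ge ▸ (he s hs.1 h).smooth
  compatible := fun _ hs _ hts => hg.compatible_glueAbove (by omega) he hs hts
  vanishes := fun s hs => by
    rcases mem_skeleton_or_card_eq hs with h | h
    · exact glueAbove_of_le h.2 ▸ hg.vanishes s h
    · exact glueAbove_of_lt h.ge ▸ (he s (hAX hs.1) h).vanishes hs.1
  extD_eq := fun s hs => by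
    rcases mem_skeleton_or_card_eq hs with h | h
    · exact glueAbove_of_le h.2 ▸ hg.extD_eq s h
    · exact glueAbove_of_lt h.ge ▸ (he s hs.1 h).extD_eq
  eq_zero_of_card := fun s hs hk => by
    rw [glueAbove_of_le (hk.trans_le hkm)]
    exact hg.eq_zero_of_card s hs hk

theorem isSkeletalPrimitive_zero (f : ∀ s : Finset V, LocalForm s (k + 1)) :
    IsSkeletalPrimitive X A (k + 1) f 0 where
  toIsRelativeForm := .zero
  extD_eq := fun _ hs _ hx =>
    (LocalForm.extD_eq_zero (fun _ _ => rfl) hx).trans (eqOn_zero_of_card_le _ hs.2 hx).symm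
  eq_zero_of_card := fun _ _ _ _ _ => rfl

theorem exists_isSkeletalPrimitive (hAX : A ≤ X) (hkm : k + 1 ≤ m) :
    ∃ C : ℝ, 0 ≤ C ∧ ∀ f : ∀ s : Finset V, LocalForm s (k + 1), IsPeriodFreeCocycle X A f →
      ∃ g, IsSkeletalPrimitive X A m f g ∧ ∀ M : ℝ, 0 ≤ M → (∀ s ∈ X.faces, BoundedBy (f s) M) →
        ∀ s ∈ (skeleton X m).faces, BoundedBy (g s) (C * M) := by
  induction m, hkm using Nat.le_induction with
  | base =>
    exact ⟨0, le_rfl, fun f _ => ⟨0, isSkeletalPrimitive_zero f,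
      fun M _ _ _ _ => (zero_mul M).symm ▸ .zero⟩⟩
  | succ m hkm ih =>
    have hm : 0 < m := by omega
    obtain ⟨C₀, hC₀, hprim⟩ := ih
    obtain ⟨C₁, hC₁, hext⟩ := exists_isPrimitiveOver_all X A k hm
    refine ⟨C₀ + C₁ * (1 + C₀), by positivity, fun f hf => ?_⟩
    obtain ⟨g, hg, hgM⟩ := hprim f hf
    obtain ⟨e, he⟩ := hext f g hf hg
    refine ⟨_, hg.glueAbove hAX hkm fun s hs h => (he s hs h).1, fun M hM hfM s hs => ?_⟩
    have hC₀M : 0 ≤ C₀ * M := by positivity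
    rcases mem_skeleton_or_card_eq hs with h | h
    · rw [glueAbove_of_le h.2]
      exact (hgM M hM hfM s h).mono
        (mul_le_mul_of_nonneg_right (le_add_of_nonneg_right (by positivity)) hM)
    · have hesM : BoundedBy (e s) (C₁ * ((1 + C₀) * M)) :=
        (he s hs.1 h).2 _ (by positivity) ((hfM s hs.1).mono (by linarith)) fun j hj =>
          (hgM M hM hfM _ (erase_mem_skeleton hs.1 h hm hj)).mono (by linarith)
      rw [glueAbove_of_lt h.ge]
      exact hesM.mono (by linarith)

end SkeletalInduction

section Pairs

open LocalForm

variable {V : Type*} [Fintype V] [LinearOrder V] {X A : PreAbstractSimplicialComplex V} {k : ℕ}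

theorem exists_primitive_of_isPeriodFreeCocycle (hAX : A ≤ X) (k : ℕ) :
    ∃ C : ℝ, 0 ≤ C ∧ ∀ f : ∀ s : Finset V, LocalForm s (k + 1), IsPeriodFreeCocycle X A f →
      ∃ g : relForms X A k, (∀ s ∈ X.faces, EqOn (extD (g.1 s)) (f s) (closedSimplex s)) ∧
        ∀ M : ℝ, 0 ≤ M → (∀ s ∈ X.faces, BoundedBy (f s) M) →
          ∀ s ∈ X.faces, BoundedBy (g.1 s) (C * M) := by
  obtain ⟨C, hC, hprim⟩ := exists_isSkeletalPrimitive hAX (le_max_left (k + 1) (Fintype.card V))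
  have hX := skeleton_eq_self (X := X) (le_max_right (k + 1) (Fintype.card V))
  have hA := skeleton_eq_self (X := A) (le_max_right (k + 1) (Fintype.card V))
  refine ⟨C, hC, fun f hf => ?_⟩
  obtain ⟨g, hg, hgM⟩ := hprim f hf
  have hrel := hg.toIsRelativeForm
  have hext := hg.extD_eq
  rw [hX] at hrel hext hgM
  rw [hA] at hrel
  exact ⟨⟨g, hrel⟩, hext, hgM⟩

theorem isPeriodFreeCocycle_extD_sub {f g : relForms X A k}
    (h : periods X A k g = periods X A k f) :
    IsPeriodFreeCocycle X A fun s => extD ((f - g).1 s) where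
  toIsRelativeForm := (f - g).2.extD
  extD_eq_zero := fun s hs _ hx => extD_extD ((f - g).2.smooth s hs) hx
  integral_eq_zero := fun s hs hk => by
    have hsub : periods X A k (f - g) = 0 := by
      rw [LinearMap.map_sub (M := relForms X A k) _ f g, h, sub_self]
    exact congrFun hsub ⟨s, hs, hk⟩

theorem exists_bounded_relative_primitive (hAX : A ≤ X) (k : ℕ) :
    ∃ C : ℝ, 0 ≤ C ∧ ∀ f : relForms X A k, ∃ g : relForms X A k,
      (∀ s ∈ X.faces, EqOn (extD (g.1 s)) (extD (f.1 s)) (closedSimplex s)) ∧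
      ∀ M : ℝ, 0 ≤ M → (∀ s ∈ X.faces, BoundedBy (extD (f.1 s)) M) →
        ∀ s ∈ X.faces, BoundedBy (g.1 s) (C * M) := by
  obtain ⟨C₁, hC₁, hcorr⟩ := exists_bounded_period_correction X A k
  obtain ⟨C₂, hC₂, hprim⟩ := exists_primitive_of_isPeriodFreeCocycle hAX k
  refine ⟨C₁ + C₂ * (1 + C₁), by positivity, fun f => ?_⟩
  obtain ⟨c, hc, hcM⟩ := hcorr f
  obtain ⟨g, hg, hgM⟩ := hprim _ (isPeriodFreeCocycle_extD_sub hc)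
  have hsub : ∀ s ∈ X.faces,
      EqOn (extD ((f - c).1 s)) (extD (f.1 s) - extD (c.1 s)) (closedSimplex s) :=
    fun s hs _ hx => extD_sub (f.2.smooth s hs) (c.2.smooth s hs) hx
  refine ⟨g + c, fun s hs x hx => ?_, fun M hM hfM s hs => ?_⟩
  · refine (extD_add (g.2.smooth s hs) (c.2.smooth s hs) hx).trans ?_
    rw [hg s hs hx, hsub s hs hx]
    exact sub_add_cancel _ _
  · have hgs : BoundedBy (g.1 s) (C₂ * (M + C₁ * M)) :=
      hgM _ (by positivity) (fun t ht =>
        ((hfM t ht).sub (hcM M hM hfM t ht).2).congr (hsub t ht)) s hs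
    exact (hgs.add (hcM M hM hfM s hs).1).mono (by linarith)

/-- The simplexwise form given by a compatible family of forms. -/
def IsRelativeForm.toSimplexwiseForm {f : ∀ s : Finset V, LocalForm s k}
    (hf : IsRelativeForm X A f) : SimplexwiseForm X k where
  toFun := f
  smooth := hf.smooth
  compatible := fun s _ t ht h _ hx w => DFunLike.congr_fun (hf.compatible t ht s h hx) w

theorem exists_bounded_primitive_of_exact (hAX : A ≤ X) (k : ℕ) :
    ∃ C : ℝ≥0, ∀ η : SimplexwiseForm X (k + 1),
      (∃ b : SimplexwiseForm X k, (b.restrict hAX).IsZero ∧ b.IsPrimitiveOf η) →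
      ∃ a : SimplexwiseForm X k, (a.restrict hAX).IsZero ∧ a.IsPrimitiveOf η ∧
        a.supNorm ≤ C * η.supNorm := by
  obtain ⟨C, hC, hprim⟩ := exists_bounded_relative_primitive hAX k
  refine ⟨C.toNNReal + 1, fun η => ?_⟩
  rintro ⟨b, hb, hbη⟩
  rw [SimplexwiseForm.isPrimitiveOf_iff] at hbη
  obtain ⟨a, ha, haM⟩ := hprim ⟨b.toFun, b.isRelativeForm_toFun hb⟩
  refine ⟨a.2.toSimplexwiseForm, a.2.vanishes, SimplexwiseForm.isPrimitiveOf_iff.2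
    fun s hs => (ha s hs).trans (hbη s hs), SimplexwiseForm.supNorm_le _ hC
    fun hN => haM _ ENNReal.toReal_nonneg fun s hs => ?_⟩
  exact (η.boundedBy_toReal hN le_rfl hs).congr (hbη s hs)

end Pairs

end SimplicialForms

end

theorem mainTheorem9 :
    -- first quantitative Poincaré lemma, for forms of degree `k + 1` with `0 < k + 1 ≤ n`
    (∀ n k : ℕ, k + 1 ≤ n → ∃ C : ℝ≥0, ∀ ω : SimplexwiseForm (stdComplex n) (k + 1),
      ω.IsClosedForm → (ω.restrict (bdryComplex_le n)).IsZero →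
      (∀ h : k + 1 = n, stdIntegral ω h = 0) →
      ∃ α : SimplexwiseForm (stdComplex n) k,
        (α.restrict (bdryComplex_le n)).IsZero ∧ α.IsPrimitiveOf ω ∧
        α.supNorm ≤ C * ω.supNorm) ∧
    -- second quantitative Poincaré lemma, for forms of degree `k + 1` with `0 < k + 1 ≤ n`
    (∀ n k : ℕ, k + 1 ≤ n → ∃ C : ℝ≥0, ∀ (ω : SimplexwiseForm (stdComplex n) (k + 1))
      (αb : SimplexwiseForm (bdryComplex n) k),
      ω.IsClosedForm → αb.IsPrimitiveOf (ω.restrict (bdryComplex_le n)) →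
      (∀ h : k + 1 = n, stdIntegral ω h = bdryIntegral αb h) →
      ∃ α : SimplexwiseForm (stdComplex n) k,
        (α.restrict (bdryComplex_le n)).Agrees αb ∧ α.IsPrimitiveOf ω ∧
        α.supNorm ≤ C * (ω.supNorm + αb.supNorm)) ∧
    -- bounded relative primitives on a finite simplicial pair
    (∀ (V : Type*) [Fintype V] [DecidableEq V] (X A : PreAbstractSimplicialComplex V)
      (hAX : A ≤ X) (k : ℕ), ∃ C : ℝ≥0, ∀ ω : SimplexwiseForm X (k + 1),
      (∃ β : SimplexwiseForm X k, (β.restrict hAX).IsZero ∧ β.IsPrimitiveOf ω) →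
      ∃ α : SimplexwiseForm X k, (α.restrict hAX).IsZero ∧ α.IsPrimitiveOf ω ∧
        α.supNorm ≤ C * ω.supNorm) := by
  refine ⟨fun n k hk => exists_primitive_vanishing_on_bdryComplex (Nat.zero_lt_of_lt hk) k,
    fun n k hk => exists_primitive_extending_stdComplex (Nat.zero_lt_of_lt hk) k, ?_⟩
  intro V _ inst X A hAX k
  let L : LinearOrder V := LinearOrder.lift' (Fintype.equivFin V) (Fintype.equivFin V).injective
  obtain rfl : inst = L.toDecidableEq := Subsingleton.elim _ _
  exact exists_bounded_primitive_of_exact hAX k
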